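/- Let $G$ be a compact (Hausdorff) abelian group with normalized Haar measure $\mu$ and dual group $\Gamma$ (the continuous characters of $G$), and let $\hat f(\gamma)=\int_G f\,\overline{\gamma}\,d\mu$ for $f\in C(G)$, the continuous complex-valued functions on $G$. A set $E\subset\Gamma$ is a Sidon set if there is a constant $C>0$ such that $$\sum_{\gamma\in\Gamma}|\hat f(\gamma)|\le C\|f\|_\infty$$ for every $f\in C(G)$ with $\hat f=0$ outside $E$; the infimum of these constants $C>0$ is the Sidon constant $S(E)$. For a finite or infinite sequence $a=(a_n)\in\ell^2$ of complex numbers let $(a_n^*)_{n\ge1}$ be the nonincreasing rearrangement of $(|a_n|)$ (continued by zeros if $a$ is finite), and for $0<t<\infty$ let $$K_{1,2}(a,t)=\sum_{n=1}^{[t^2]}a_n^*+t\Big(\sum_{n=[t^2]+1}^\infty (a_n^*)^2\Big)^{1/2},$$ where $[\,\cdot\,]$ denotes the integer part. **Theorem.** Let $E=(\gamma_n)\subset\Gamma$ be a Sidon set, where the $\gamma_n$ are distinct and $E$ is finite or countably infinite. There is a constant $c>0$, depending only on $S(E)$ (and not on $G$, $E$ or $a$), such that for every family $a=(a_n)\in\ell^2$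 of complex numbers with the same index set as $(\gamma_n)$, the series $\sum_n a_n\gamma_n$ converges (unconditionally) in $L^2(\mu)$, and for all $t>0$ $$\mu\Big[\Big|\sum_n a_n\gamma_n\Big|\ge c\,K_{1,2}(a,t)\Big]\le c\,e^{-c^{-1}t^2}\qquad\text{if } a\ne0,$$ $$\mu\Big[\Big|\sum_n a_n\gamma_n\Big|\ge c^{-1}K_{1,2}(a,t)\Big]\ge c^{-1}e^{-ct^2}.$$ -/

import Mathlib

open MeasureTheory
open scoped ENNReal

universe u v

noncomputable section

/-- A character `χ : G → 𝕋`, viewed as a continuous complex-valued function on `G`. -/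
def characterFun {G : Type u} [CommGroup G] [TopologicalSpace G] (χ : PontryaginDual G) : C(G, ℂ) where
  toFun x := (χ x : ℂ)
  continuous_toFun := continuous_subtype_val.comp (map_continuous χ)

/-- The Fourier coefficient `f̂(χ) = ∫ f(x) conj (χ(x)) dμ(x)`. -/
def fourierCoefficient {G : Type u} [CommGroup G] [TopologicalSpace G] [MeasurableSpace G]
    (μ : Measure G) (f : C(G, ℂ)) (χ : PontryaginDual G) : ℂ :=
  ∫ x, f x * (starRingEnd ℂ) (characterFun χ x) ∂μ

/-- The inequality `∑_χ |f̂(χ)| ≤ c ‖f‖_∞` for every continuous `f` whose Fourier transform is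
supported in `E`. The sum is taken in `[0, ∞]`, so its finiteness is part of the claim. -/
def SidonBound {G : Type u} [CommGroup G] [TopologicalSpace G] [CompactSpace G]
    [MeasurableSpace G] (μ : Measure G) (E : Set (PontryaginDual G)) (c : ℝ) : Prop :=
  ∀ f : C(G, ℂ), (∀ χ, χ ∉ E → fourierCoefficient μ f χ = 0) →
    ∑' χ : PontryaginDual G, ‖fourierCoefficient μ f χ‖ₑ ≤ ENNReal.ofReal (c * ‖f‖)

/-- `E` is a Sidon set. -/
def IsSidon {G : Type u} [CommGroup G] [TopologicalSpace G] [CompactSpace G]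
    [MeasurableSpace G] (μ : Measure G) (E : Set (PontryaginDual G)) : Prop :=
  ∃ c : ℝ, 0 < c ∧ SidonBound μ E c

/-- The Sidon constant `S(E)`: the smallest admissible constant for a Sidon set `E`. -/
def sidonConstant {G : Type u} [CommGroup G] [TopologicalSpace G] [CompactSpace G]
    [MeasurableSpace G] (μ : Measure G) (E : Set (PontryaginDual G)) : ℝ :=
  sInf {c : ℝ | 0 < c ∧ SidonBound μ E c}

/-- The nonincreasing rearrangement of `(|a_i|)`, indexed from `0`: `rearrangement a n` is the
`(n+1)`-st largest of the numbers `|a_i|`, counted with multiplicity (and `0` when there are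
no more than `n` indices), i.e. the least `s ≥ 0` such that at most `n` of the `|a_i|`
exceed `s`. -/
def rearrangement {ι : Type v} (a : ι → ℂ) (n : ℕ) : ℝ :=
  sInf {s : ℝ | 0 ≤ s ∧ {i | s < ‖a i‖}.encard ≤ n}

/-- `K_{1,2}(a,t) = ∑_{n=1}^{[t²]} a_n^* + t (∑_{n=[t²]+1}^∞ (a_n^*)²)^{1/2}`, where `a_n^*` is
`rearrangement a (n - 1)`. -/
def K12 {ι : Type v} (a : ι → ℂ) (t : ℝ) : ℝ :=
  ∑ n ∈ Finset.range ⌊t ^ 2⌋₊, rearrangement a n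
    + t * Real.sqrt (∑' n : ℕ, rearrangement a (⌊t ^ 2⌋₊ + n) ^ 2)

end

/-!
The constants come from comparing the even moments of a Sidon series with those of a Steinhaus sum
`∑ a_i z_i`, whose `z_i` are independent and uniform on the circle.

*Comparison.* Let `R` be admissible in the Sidon inequality. If `|b_i| ≤ 1`, then
`‖∑ b_i a_i γ_i‖_p ≤ R ‖∑ a_i γ_i‖_p` (`SidonBound.integral_norm_pow_trigPoly_le`): pair the left
side `F` with `h = F |F|^{p-2}`; the pairing is at most the sum of the moduli of the coefficients
of the polynomial `y ↦ ∫ (∑ a_i γ_i)(yx) conj h(x) dx`, which the Sidon inequality bounds by `R`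
times its supremum, and Hölder bounds that. Taking for `b` a point of the torus `𝕋^ι`, averaging
over the torus and exchanging the integrals replaces `γ_i` by `z_i`. By orthogonality of monomials
the `2m`-th moment of the Steinhaus sum is the explicit polynomial `steinhausMoment`.

*Moments.* Let `A` carry the `m` largest `|a_i|`, and put `l = ∑_{i ∈ A} |a_i|` and
`σ² = ∑_{i ∉ A} |a_i|²`. Up to factors `C^m`, the `2m`-th moments are `(l + √m σ)^{2m}`. The upper
bound is the triangle inequality on `A` with the sub-Gaussian estimate off `A`. For the lower bound, either `l`
dominates and the Cauchy–Schwarz inequality over the at most `4^m` monomials in `A` gives the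
claim, or each `|a_i|` with `i ∉ A` is at most `σ / √m` and the square-free monomials off `A`
already give a moment of Gaussian size (`SidonBound.le_integral_pow`).

*Tails.* `K_{1,2}(a, t) = l + t σ` when `m = ⌊t²⌋` (`IsTopSet.K12_eq`). The upper tail is
Chebyshev's inequality for the part off `A`; the lower tail is the Paley–Zygmund inequality for the
`2m`-th power, whose second moment is the `4m`-th moment. Both are proved for polynomials and pass
to the series because convergence in `L²` implies convergence in measure.
-/

/-! ### Characters and trigonometric polynomials -/

lemma integrable_of_continuous {X : Type*} [TopologicalSpace X] [CompactSpace X]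
    [MeasurableSpace X] [BorelSpace X] (μ : Measure X) [IsFiniteMeasureOnCompacts μ]
    {E : Type*} [NormedAddCommGroup E] [SecondCountableTopologyEither X E] {f : X → E}
    (hf : Continuous f) : Integrable f μ :=
  hf.integrable_of_hasCompactSupport (HasCompactSupport.of_compactSpace f)

section Characters

variable {G : Type*} [CommGroup G] [TopologicalSpace G]

@[simp] lemma characterFun_apply (χ : PontryaginDual G) (x : G) :
    characterFun χ x = (χ x : ℂ) := rfl

lemma norm_characterFun_apply (χ : PontryaginDual G) (x : G) : ‖characterFun χ x‖ = 1 :=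
  Circle.norm_coe _

lemma characterFun_mul_apply (χ : PontryaginDual G) (x y : G) :
    characterFun χ (x * y) = characterFun χ x * characterFun χ y := by
  simp

lemma characterFun_mul_conj_apply (χ ψ : PontryaginDual G) (x : G) :
    characterFun χ x * (starRingEnd ℂ) (characterFun ψ x) = characterFun (χ * ψ⁻¹) x := by
  have h : (χ * ψ⁻¹) x = χ x * (ψ x)⁻¹ := rfl
  simp only [characterFun_apply, h, Circle.coe_mul, Circle.coe_inv_eq_conj]

/-- The trigonometric polynomial `∑_{i ∈ s} c_i γ_i`. -/
noncomputable def trigPoly {ι : Type*} (γ : ι → PontryaginDual G) (s : Finset ι) (c : ι → ℂ) :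
    C(G, ℂ) :=
  ∑ i ∈ s, c i • characterFun (γ i)

lemma trigPoly_apply {ι : Type*} (γ : ι → PontryaginDual G) (s : Finset ι) (c : ι → ℂ) (x : G) :
    trigPoly γ s c x = ∑ i ∈ s, c i * characterFun (γ i) x := by
  simp [trigPoly]

variable [MeasurableSpace G] (μ : Measure G)

lemma SidonBound.mono [CompactSpace G] {μ : Measure G} {E : Set (PontryaginDual G)}
    {c d : ℝ} (h : SidonBound μ E c) (hcd : c ≤ d) : SidonBound μ E d := fun f hf =>
  (h f hf).trans (ENNReal.ofReal_le_ofReal (mul_le_mul_of_nonneg_right hcd (norm_nonneg f)))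

variable [IsTopologicalGroup G] [BorelSpace G] [μ.IsHaarMeasure]

lemma integral_characterFun_eq_zero {χ : PontryaginDual G} (hχ : χ ≠ 1) :
    ∫ x, characterFun χ x ∂μ = 0 := by
  obtain ⟨y, hy⟩ : ∃ y, χ y ≠ 1 := by
    by_contra! h
    exact hχ (by ext x; simp [h x])
  have h := integral_mul_left_eq_self (μ := μ) (fun x => characterFun χ x) y
  simp only [characterFun_mul_apply] at h
  rw [integral_const_mul] at h
  have h1 : (characterFun χ y - 1) * ∫ x, characterFun χ x ∂μ = 0 := by
    rw [sub_mul, h, one_mul, sub_self]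
  refine (mul_eq_zero.1 h1).resolve_left fun h0 => hy ?_
  ext
  simpa using sub_eq_zero.1 h0

open Classical in
lemma integral_characterFun_mul_conj [IsProbabilityMeasure μ] (χ ψ : PontryaginDual G) :
    ∫ x, characterFun χ x * (starRingEnd ℂ) (characterFun ψ x) ∂μ = if χ = ψ then 1 else 0 := by
  simp only [characterFun_mul_conj_apply]
  split_ifs with h
  · subst h
    have : ∀ x : G, characterFun (χ * χ⁻¹) x = 1 := by
      intro x
      rw [mul_inv_cancel]
      simp
    simp only [this]
    simp
  · exact integral_characterFun_eq_zero μ (mt mul_inv_eq_one.1 h)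

variable [CompactSpace G] [IsProbabilityMeasure μ]

open Classical in
lemma fourierCoefficient_trigPoly {ι : Type*} (γ : ι → PontryaginDual G) (s : Finset ι)
    (c : ι → ℂ) (χ : PontryaginDual G) :
    fourierCoefficient μ (trigPoly γ s c) χ = ∑ i ∈ s, if γ i = χ then c i else 0 := by
  unfold fourierCoefficient
  simp only [trigPoly_apply, Finset.sum_mul, mul_assoc]
  rw [integral_finsetSum]
  · refine Finset.sum_congr rfl fun i _ => ?_
    rw [integral_const_mul, integral_characterFun_mul_conj]
    split_ifs <;> simp
  · intro i _
    exact integrable_of_continuous μ (by fun_prop)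

lemma fourierCoefficient_trigPoly_self {ι : Type*} {γ : ι → PontryaginDual G} {s : Finset ι}
    (hγ : Set.InjOn γ s) (c : ι → ℂ) {i : ι} (hi : i ∈ s) :
    fourierCoefficient μ (trigPoly γ s c) (γ i) = c i := by
  classical
  rw [fourierCoefficient_trigPoly, Finset.sum_eq_single i]
  · simp
  · intro j hj hji
    rw [if_neg fun h => hji (hγ hj hi h)]
  · exact fun h => absurd hi h

/-- Parseval's identity for trigonometric polynomials. -/
lemma integral_norm_sq_trigPoly {ι : Type*} {γ : ι → PontryaginDual G} {s : Finset ι}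
    (hγ : Set.InjOn γ s) (c : ι → ℂ) :
    ∫ x, ‖trigPoly γ s c x‖ ^ 2 ∂μ = ∑ i ∈ s, ‖c i‖ ^ 2 := by
  have key : ∫ x, ((‖trigPoly γ s c x‖ ^ 2 : ℝ) : ℂ) ∂μ = ((∑ i ∈ s, ‖c i‖ ^ 2 : ℝ) : ℂ) := by
    have h1 : ∀ x, ((‖trigPoly γ s c x‖ ^ 2 : ℝ) : ℂ) = ∑ i ∈ s, (starRingEnd ℂ) (c i) *
        (trigPoly γ s c x * (starRingEnd ℂ) (characterFun (γ i) x)) := by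
      intro x
      push_cast
      rw [← Complex.mul_conj']
      conv_lhs => rw [trigPoly_apply γ s c x, map_sum, ← trigPoly_apply, Finset.mul_sum]
      refine Finset.sum_congr rfl fun i _ => ?_
      rw [map_mul]; ring
    simp only [h1]
    rw [integral_finsetSum]
    · push_cast
      refine Finset.sum_congr rfl fun i hi => ?_
      have := fourierCoefficient_trigPoly_self μ hγ c hi
      unfold fourierCoefficient at this
      rw [integral_const_mul, this, ← Complex.conj_mul']
    · intro i _
      exact integrable_of_continuous μ (by fun_prop)
  rw [integral_complex_ofReal] at key
  exact_mod_cast key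

/-- The Sidon inequality in terms of the coefficients of a trigonometric polynomial. -/
lemma SidonBound.sum_norm_le {ι : Type*} {γ : ι → PontryaginDual G}
    (hγ : Function.Injective γ) {R : ℝ} (hR : 0 ≤ R) (h : SidonBound μ (Set.range γ) R)
    (s : Finset ι) (c : ι → ℂ) :
    ∑ i ∈ s, ‖c i‖ ≤ R * ‖trigPoly γ s c‖ := by
  classical
  have h1 := h (trigPoly γ s c) (by
    intro χ hχ
    rw [fourierCoefficient_trigPoly]
    refine Finset.sum_eq_zero fun i _ => if_neg fun hi => hχ ⟨i, hi⟩)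
  have h2 := (ENNReal.sum_le_tsum (s.image γ)).trans h1
  rw [Finset.sum_image hγ.injOn, Finset.sum_congr rfl fun i hi => by
    rw [fourierCoefficient_trigPoly_self μ hγ.injOn c hi, ← ofReal_norm],
    ← ENNReal.ofReal_sum_of_nonneg fun _ _ => norm_nonneg _,
    ENNReal.ofReal_le_ofReal_iff (by positivity)] at h2
  exact h2

end Characters

/-! ### The contraction principle for Sidon sets -/

section Contraction

/-- Hölder's inequality for the exponents `n + 1` and `(n + 1) / n`, with roots cleared. -/
lemma integral_mul_pow_le {X : Type*} [TopologicalSpace X] [CompactSpace X] [MeasurableSpace X]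
    [BorelSpace X] (μ : Measure X) [IsFiniteMeasureOnCompacts μ] {n : ℕ} (hn : 1 ≤ n)
    {u v : X → ℝ} (hu : Continuous u)
    (hv : Continuous v) (hu0 : 0 ≤ u) (hv0 : 0 ≤ v) :
    (∫ x, u x * v x ^ n ∂μ) ^ (n + 1) ≤ (∫ x, u x ^ (n + 1) ∂μ) * (∫ x, v x ^ (n + 1) ∂μ) ^ n := by
  have hn0 : (0 : ℝ) < n := by exact_mod_cast hn
  have hpq : ((n + 1 : ℕ) : ℝ).HolderConjugate (((n + 1 : ℕ) : ℝ) / n) := by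
    rw [Real.holderConjugate_iff]
    refine ⟨by push_cast; linarith, ?_⟩
    push_cast; field_simp; ring
  have hmem : ∀ {w : X → ℝ} (p : ℝ≥0∞), Continuous w → MemLp w p μ := fun p hw =>
    hw.memLp_of_hasCompactSupport (HasCompactSupport.of_compactSpace _)
  have h := integral_mul_le_Lp_mul_Lq_of_nonneg (μ := μ) hpq (f := u) (g := fun x => v x ^ n)
    (.of_forall hu0) (.of_forall fun x => pow_nonneg (hv0 x) n) (hmem _ hu) (hmem _ (hv.pow n))
  have e : ∀ x, (v x ^ n) ^ (((n + 1 : ℕ) : ℝ) / n) = v x ^ (n + 1) := by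
    intro x
    rw [← Real.rpow_natCast, ← Real.rpow_mul (hv0 x), mul_div_cancel₀ _ hn0.ne', Real.rpow_natCast]
  simp only [e, Real.rpow_natCast] at h
  have hU : 0 ≤ ∫ x, u x ^ (n + 1) ∂μ := integral_nonneg fun x => pow_nonneg (hu0 x) _
  have hV : 0 ≤ ∫ x, v x ^ (n + 1) ∂μ := integral_nonneg fun x => pow_nonneg (hv0 x) _
  refine (pow_le_pow_left₀ (integral_nonneg fun x =>
    mul_nonneg (hu0 x) (pow_nonneg (hv0 x) _)) h (n + 1)).trans_eq ?_
  rw [mul_pow, ← Real.rpow_natCast, ← Real.rpow_mul hU, ← Real.rpow_natCast (_ ^ _),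
    ← Real.rpow_mul hV, one_div_mul_cancel (by positivity), Real.rpow_one, one_div_div,
    div_mul_cancel₀ _ (by positivity), Real.rpow_natCast]

variable {G : Type*} [CommGroup G] [TopologicalSpace G] [IsTopologicalGroup G] [CompactSpace G]
  [MeasurableSpace G] [BorelSpace G] (μ : Measure G) [μ.IsHaarMeasure] [IsProbabilityMeasure μ]

/-- **Contraction principle for Sidon sets.** Multiplying the coefficients of a trigonometric
polynomial with spectrum in a Sidon set by numbers of modulus at most one changes its `L^p` norm
by at most the Sidon constant. The classical argument convolves with a measure interpolating the
multipliers; here the Sidon inequality is applied directly to the convolution of the polynomial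
with the dual extremal function of the new one. -/
lemma SidonBound.integral_norm_pow_trigPoly_le {ι : Type*} {γ : ι → PontryaginDual G}
    (hγ : Function.Injective γ) {R : ℝ} (hR : 0 ≤ R) (h : SidonBound μ (Set.range γ) R)
    (s : Finset ι) (a b : ι → ℂ) (hb : ∀ i, ‖b i‖ ≤ 1) {n : ℕ} (hn : 1 ≤ n) :
    ∫ x, ‖trigPoly γ s (fun i => b i * a i) x‖ ^ (n + 1) ∂μ ≤
      R ^ (n + 1) * ∫ x, ‖trigPoly γ s a x‖ ^ (n + 1) ∂μ := by
  set F := trigPoly γ s (fun i => b i * a i) with hF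
  set g := trigPoly γ s a with hg
  set I := ∫ x, ‖F x‖ ^ (n + 1) ∂μ with hI
  set J := ∫ x, ‖g x‖ ^ (n + 1) ∂μ with hJ
  have hI0 : 0 ≤ I := integral_nonneg fun x => by positivity
  have hJ0 : 0 ≤ J := integral_nonneg fun x => by positivity
  -- The conjugate of the extremal function for `F` in the duality of `L^(n+1)`.
  let k : G → ℂ := fun x => (starRingEnd ℂ) (F x) * ((‖F x‖ ^ (n - 1) : ℝ) : ℂ)
  have hk : Continuous k := by fun_prop
  have hkn : ∀ x, ‖k x‖ = ‖F x‖ ^ n := by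
    intro x
    simp only [k, norm_mul, RCLike.norm_conj, Complex.norm_real, norm_pow, norm_norm]
    rw [← pow_succ', Nat.sub_add_cancel hn]
  -- The coefficients of the polynomial `y ↦ ∫ g (y x) k x dx`.
  let e : ι → ℂ := fun i => a i * ∫ x, characterFun (γ i) x * k x ∂μ
  have h1 : (I : ℂ) = ∑ i ∈ s, b i * e i := by
    rw [hI, ← integral_complex_ofReal]
    have : ∀ x, ((‖F x‖ ^ (n + 1) : ℝ) : ℂ) =
        ∑ i ∈ s, (b i * a i) * (characterFun (γ i) x * k x) := by
      intro x
      have h2 : ((‖F x‖ ^ (n + 1) : ℝ) : ℂ) = F x * k x := by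
        simp only [k]
        rw [← mul_assoc, Complex.mul_conj']
        push_cast
        rw [← pow_add]
        congr 1; omega
      rw [h2]
      conv_lhs => rw [hF, trigPoly_apply, Finset.sum_mul]
      exact Finset.sum_congr rfl fun i _ => by ring
    simp only [this]
    rw [integral_finsetSum _ fun i _ => integrable_of_continuous μ (by fun_prop)]
    refine Finset.sum_congr rfl fun i _ => ?_
    rw [integral_const_mul]; simp only [e]; ring
  have h2 : I ≤ ∑ i ∈ s, ‖e i‖ := by
    have : I = ‖(I : ℂ)‖ := by rw [Complex.norm_real, Real.norm_of_nonneg hI0]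
    rw [this, h1]
    refine (norm_sum_le _ _).trans (Finset.sum_le_sum fun i _ => ?_)
    rw [norm_mul]
    exact mul_le_of_le_one_left (norm_nonneg _) (hb i)
  have h3 : ∀ y, trigPoly γ s e y = ∫ x, g (y * x) * k x ∂μ := by
    intro y
    have : ∀ x, g (y * x) * k x =
        ∑ i ∈ s, (a i * characterFun (γ i) y) * (characterFun (γ i) x * k x) := by
      intro x
      rw [hg, trigPoly_apply, Finset.sum_mul]
      refine Finset.sum_congr rfl fun i _ => ?_
      rw [characterFun_mul_apply]; ring
    simp only [this]
    rw [integral_finsetSum _ fun i _ => integrable_of_continuous μ (by fun_prop), trigPoly_apply]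
    refine Finset.sum_congr rfl fun i _ => ?_
    rw [integral_const_mul]; simp only [e]; ring
  have h4 : ∀ y, ‖trigPoly γ s e y‖ ^ (n + 1) ≤ J * I ^ n := by
    intro y
    have h5 : ‖trigPoly γ s e y‖ ≤ ∫ x, ‖g (y * x)‖ * ‖F x‖ ^ n ∂μ := by
      rw [h3]
      refine (norm_integral_le_integral_norm _).trans_eq ?_
      simp only [norm_mul, hkn]
    refine (pow_le_pow_left₀ (norm_nonneg _) h5 _).trans ?_
    refine (integral_mul_pow_le μ hn (by fun_prop) (by fun_prop) (fun _ => norm_nonneg _)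
      (fun _ => norm_nonneg _)).trans_eq ?_
    rw [integral_mul_left_eq_self (μ := μ) (fun x => ‖g x‖ ^ (n + 1)) y]
  have h6 : ‖trigPoly γ s e‖ ^ (n + 1) ≤ J * I ^ n := by
    obtain ⟨y, -, hy⟩ := isCompact_univ.exists_isMaxOn (Set.univ_nonempty (α := G))
      (f := fun y => ‖trigPoly γ s e y‖) (by fun_prop)
    exact (pow_le_pow_left₀ (norm_nonneg _) ((ContinuousMap.norm_le _ (norm_nonneg _)).2
      fun z => hy (Set.mem_univ z)) _).trans (h4 y)
  have h7 : I ^ (n + 1) ≤ R ^ (n + 1) * J * I ^ n := by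
    have := pow_le_pow_left₀ hI0 (h2.trans (h.sum_norm_le μ hγ hR s e)) (n + 1)
    rw [mul_pow] at this
    refine this.trans ?_
    rw [mul_assoc]
    exact mul_le_mul_of_nonneg_left h6 (by positivity)
  rcases hI0.eq_or_lt with h8 | h8
  · rw [← h8]; positivity
  · rw [pow_succ'] at h7
    exact le_of_mul_le_mul_right h7 (by positivity)

end Contraction

/-! ### Comparison with Steinhaus sums -/

section Steinhaus

variable {ι : Type*}

open Classical in
/-- The `2m`-th moment `∫ |∑_{i ∈ s} c_i z_i|^{2m}` of a Steinhaus sum, as a polynomial in the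
numbers `w_i = |c_i|²`. -/
noncomputable def steinhausMoment (s : Finset ι) (w : ι → ℝ) (m : ℕ) : ℝ :=
  ∑ α ∈ s.piAntidiag m, (Nat.multinomial s α : ℝ) ^ 2 * ∏ i ∈ s, w i ^ α i

/-- The character `z ↦ ∏_{i ∈ s} z_i ^ α_i` of the torus `𝕋^ι`. -/
noncomputable def monomialChar (s : Finset ι) (α : ι → ℕ) : PontryaginDual (ι → Circle) where
  toFun z := ∏ i ∈ s, z i ^ α i
  map_one' := by simp
  map_mul' z w := by simp [mul_pow, Finset.prod_mul_distrib]
  continuous_toFun := by fun_prop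

lemma monomialChar_apply (s : Finset ι) (α : ι → ℕ) (z : ι → Circle) :
    characterFun (monomialChar s α) z = ∏ i ∈ s, (z i : ℂ) ^ α i := by
  have : monomialChar s α z = ∏ i ∈ s, z i ^ α i := rfl
  rw [characterFun_apply, this]
  exact (map_prod Circle.coeHom _ s).trans (Finset.prod_congr rfl fun i _ => map_pow _ _ _)

lemma Circle.pow_right_injective_of_forall {p q : ℕ} (h : ∀ w : Circle, w ^ p = w ^ q) :
    p = q := by
  -- `exp i` has infinite order because `π` is irrational.
  have h1 := h (Circle.exp 1)
  rw [← Circle.exp_natCast_mul, ← Circle.exp_natCast_mul, Circle.exp_eq_exp] at h1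
  obtain ⟨k, hk⟩ := h1
  rcases eq_or_ne k 0 with rfl | hk0
  · simpa using hk
  · exfalso
    refine irrational_pi ⟨((p : ℚ) - q) / (2 * k), ?_⟩
    have : (k : ℝ) ≠ 0 := by exact_mod_cast hk0
    push_cast
    field_simp
    linarith

open Classical in
lemma injOn_monomialChar (s : Finset ι) (m : ℕ) :
    Set.InjOn (monomialChar s) (s.piAntidiag m : Set (ι → ℕ)) := by
  intro α hα β hβ h
  have hα := (Finset.mem_piAntidiag.1 hα).2
  have hβ := (Finset.mem_piAntidiag.1 hβ).2
  funext i
  by_cases hi : i ∈ s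
  · refine Circle.pow_right_injective_of_forall fun w => ?_
    have h1 : ∀ δ : ι → ℕ, monomialChar s δ (Pi.mulSingle i w) = w ^ δ i := by
      intro δ
      change ∏ j ∈ s, (Pi.mulSingle i w : ι → Circle) j ^ δ j = _
      rw [Finset.prod_eq_single_of_mem i hi fun j _ hj => by
        rw [Pi.mulSingle_eq_of_ne hj, one_pow], Pi.mulSingle_eq_same]
    rw [← h1, ← h1, h]
  · rw [not_imp_comm.1 (hα i) hi, not_imp_comm.1 (hβ i) hi]

lemma exists_haar_probability [MeasurableSpace (ι → Circle)] [BorelSpace (ι → Circle)] :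
    ∃ ν : Measure (ι → Circle), ν.IsHaarMeasure ∧ IsProbabilityMeasure ν :=
  ⟨Measure.haarMeasure ⊤, inferInstance, ⟨Measure.haarMeasure_self (K₀ := ⊤)⟩⟩

lemma integral_steinhaus_pow [MeasurableSpace (ι → Circle)]
    [BorelSpace (ι → Circle)] (ν : Measure (ι → Circle)) [ν.IsHaarMeasure]
    [IsProbabilityMeasure ν] (s : Finset ι) (c : ι → ℂ) (m : ℕ) :
    ∫ z, ‖∑ i ∈ s, (z i : ℂ) * c i‖ ^ (2 * m) ∂ν = steinhausMoment s (fun i => ‖c i‖ ^ 2) m := by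
  classical
  have h1 : ∀ z : ι → Circle, ‖∑ i ∈ s, (z i : ℂ) * c i‖ ^ (2 * m) =
      ‖trigPoly (monomialChar s) (s.piAntidiag m)
        (fun α => (Nat.multinomial s α : ℂ) * ∏ i ∈ s, c i ^ α i) z‖ ^ 2 := by
    intro z
    rw [mul_comm 2 m, pow_mul, ← norm_pow, Finset.sum_pow_eq_sum_piAntidiag, trigPoly_apply]
    congr 2
    refine Finset.sum_congr rfl fun α _ => ?_
    simp only [monomialChar_apply, mul_pow, Finset.prod_mul_distrib]
    ring
  simp only [h1]
  rw [integral_norm_sq_trigPoly ν (injOn_monomialChar s m), steinhausMoment]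
  refine Finset.sum_congr (by congr!) fun α _ => ?_
  rw [norm_mul, mul_pow, Complex.norm_natCast, norm_prod, ← Finset.prod_pow]
  simp only [norm_pow, ← pow_mul, mul_comm]

section Comparison

variable {G : Type*} [CommGroup G] [TopologicalSpace G] [CompactSpace G]
  [MeasurableSpace G] [BorelSpace G] (μ : Measure G) [μ.IsHaarMeasure] [IsProbabilityMeasure μ]

lemma integral_integral_steinhaus [MeasurableSpace (ι → Circle)]
    [BorelSpace (ι → Circle)] (ν : Measure (ι → Circle)) [ν.IsHaarMeasure]
    [IsProbabilityMeasure ν] (γ : ι → PontryaginDual G) (s : Finset ι) (a : ι → ℂ) (m : ℕ) :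
    ∫ z, ∫ x, ‖trigPoly γ s (fun i => (z i : ℂ) * a i) x‖ ^ (2 * m) ∂μ ∂ν =
      steinhausMoment s (fun i => ‖a i‖ ^ 2) m := by
  simp only [trigPoly_apply]
  rw [integral_integral_swap_of_hasCompactSupport]
  · have : ∀ x, ∫ z : ι → Circle, ‖∑ i ∈ s, (z i : ℂ) * a i * characterFun (γ i) x‖ ^ (2 * m) ∂ν =
        steinhausMoment s (fun i => ‖a i‖ ^ 2) m := by
      intro x
      simp only [mul_assoc]
      rw [integral_steinhaus_pow ν s (fun i => a i * characterFun (γ i) x) m]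
      simp only [norm_mul, norm_characterFun_apply, mul_one]
    simp only [this]
    simp
  · fun_prop
  · exact HasCompactSupport.of_compactSpace _

variable [IsTopologicalGroup G]

/-- The even moments of a polynomial with spectrum in a Sidon set are at most those of the
corresponding Steinhaus sum, up to the Sidon constant. -/
lemma SidonBound.integral_le_steinhausMoment [Countable ι] {γ : ι → PontryaginDual G}
    (hγ : Function.Injective γ) {R : ℝ} (hR : 0 ≤ R) (h : SidonBound μ (Set.range γ) R)
    (s : Finset ι) (a : ι → ℂ) {m : ℕ} (hm : 1 ≤ m) :
    ∫ x, ‖trigPoly γ s a x‖ ^ (2 * m) ∂μ ≤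
      R ^ (2 * m) * steinhausMoment s (fun i => ‖a i‖ ^ 2) m := by
  borelize (ι → Circle)
  obtain ⟨ν, hν, hν'⟩ := exists_haar_probability (ι := ι)
  obtain ⟨n, hn1, hn⟩ : ∃ n, 1 ≤ n ∧ 2 * m = n + 1 := ⟨2 * m - 1, by omega, by omega⟩
  rw [← integral_integral_steinhaus μ ν γ s a m, ← integral_const_mul]
  have hc : Continuous fun z : ι → Circle =>
      ∫ x, ‖trigPoly γ s (fun i => (z i : ℂ) * a i) x‖ ^ (2 * m) ∂μ := by
    simp only [trigPoly_apply]
    simpa using continuous_parametric_integral_of_continuous (μ := μ) (s := Set.univ)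
      (f := fun (z : ι → Circle) x => ‖∑ i ∈ s, (z i : ℂ) * a i * characterFun (γ i) x‖ ^ (2 * m))
      (by fun_prop) isCompact_univ
  have h1 : ∀ z : ι → Circle, ∫ x, ‖trigPoly γ s a x‖ ^ (2 * m) ∂μ ≤ R ^ (2 * m) *
      ∫ x, ‖trigPoly γ s (fun i => (z i : ℂ) * a i) x‖ ^ (2 * m) ∂μ := by
    intro z
    have := h.integral_norm_pow_trigPoly_le μ hγ hR s (fun i => (z i : ℂ) * a i)
      (fun i => ((z i)⁻¹ : Circle)) (fun i => (Circle.norm_coe _).le) hn1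
    simp only [← mul_assoc, ← Circle.coe_mul, inv_mul_cancel, Circle.coe_one, one_mul, ← hn] at this
    exact this
  have h2 := integral_mono (μ := ν) (integrable_const _)
    (integrable_of_continuous ν (hc.const_mul (R ^ (2 * m)))) h1
  simpa using h2

/-- The even moments of a polynomial with spectrum in a Sidon set are at least those of any
partial Steinhaus sum, up to the Sidon constant. -/
lemma SidonBound.steinhausMoment_le_integral [Countable ι] {γ : ι → PontryaginDual G}
    (hγ : Function.Injective γ) {R : ℝ} (hR : 0 ≤ R) (h : SidonBound μ (Set.range γ) R)
    {s t : Finset ι} (hst : s ⊆ t) (a : ι → ℂ) {m : ℕ} (hm : 1 ≤ m) :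
    steinhausMoment s (fun i => ‖a i‖ ^ 2) m ≤
      R ^ (2 * m) * ∫ x, ‖trigPoly γ t a x‖ ^ (2 * m) ∂μ := by
  classical
  borelize (ι → Circle)
  obtain ⟨ν, hν, hν'⟩ := exists_haar_probability (ι := ι)
  obtain ⟨n, hn1, hn⟩ : ∃ n, 1 ≤ n ∧ 2 * m = n + 1 := ⟨2 * m - 1, by omega, by omega⟩
  rw [← integral_integral_steinhaus μ ν γ s a m]
  have hc : Continuous fun z : ι → Circle =>
      ∫ x, ‖trigPoly γ s (fun i => (z i : ℂ) * a i) x‖ ^ (2 * m) ∂μ := by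
    simp only [trigPoly_apply]
    simpa using continuous_parametric_integral_of_continuous (μ := μ) (s := Set.univ)
      (f := fun (z : ι → Circle) x => ‖∑ i ∈ s, (z i : ℂ) * a i * characterFun (γ i) x‖ ^ (2 * m))
      (by fun_prop) isCompact_univ
  have h1 : ∀ z : ι → Circle, ∫ x, ‖trigPoly γ s (fun i => (z i : ℂ) * a i) x‖ ^ (2 * m) ∂μ ≤
      R ^ (2 * m) * ∫ x, ‖trigPoly γ t a x‖ ^ (2 * m) ∂μ := by
    intro z
    have := h.integral_norm_pow_trigPoly_le μ hγ hR t a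
      (fun i => if i ∈ s then (z i : ℂ) else 0)
      (fun i => by split_ifs; exacts [(Circle.norm_coe _).le, by simp]) hn1
    rw [← hn] at this
    convert this using 5
    rw [trigPoly_apply, trigPoly_apply, ← Finset.sum_subset hst]
    · exact Finset.sum_congr rfl fun i hi => by rw [if_pos hi]
    · intro i _ hi
      rw [if_neg hi]; simp
  have h2 := integral_mono (μ := ν) (integrable_of_continuous ν hc) (integrable_const _) h1
  simpa using h2

end Comparison

end Steinhaus

/-! ### Moments of Steinhaus sums -/

section MomentBounds

variable {ι : Type*}

open Classical in
lemma Finset.card_piAntidiag_le (s : Finset ι) (m : ℕ) :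
    (s.piAntidiag m).card ≤ 2 ^ (s.card + m) := by
  have h : (s.piAntidiag m).card = (s.finsuppAntidiag m).card := by simp [Finset.finsuppAntidiag]
  rw [h, Finset.card_finsuppAntidiag_nat_eq_choose]
  exact (Nat.choose_le_two_pow _ _).trans (Nat.pow_le_pow_right two_pos (Nat.sub_le _ _))

/-- The sub-Gaussian bound for the moments of Steinhaus sums. -/
lemma steinhausMoment_le (s : Finset ι) {w : ι → ℝ} (hw : ∀ i, 0 ≤ w i) (m : ℕ) :
    steinhausMoment s w m ≤ (m * ∑ i ∈ s, w i) ^ m := by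
  classical
  have h1 : steinhausMoment s w m ≤ (m.factorial : ℝ) * (∑ i ∈ s, w i) ^ m := by
    rw [steinhausMoment, Finset.sum_pow_eq_sum_piAntidiag, Finset.mul_sum]
    refine (Finset.sum_le_sum fun α hα => ?_).trans_eq (by congr!)
    have h2 : Nat.multinomial s α ≤ m.factorial := by
      rw [← (Finset.mem_piAntidiag.1 hα).1]
      exact Nat.div_le_self _ _
    have h3 : (Nat.multinomial s α : ℝ) ≤ m.factorial := by exact_mod_cast h2
    have h4 : 0 ≤ ∏ i ∈ s, w i ^ α i := Finset.prod_nonneg fun i _ => pow_nonneg (hw i) _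
    rw [sq, mul_assoc]
    exact mul_le_mul_of_nonneg_right h3 (by positivity)
  have h5 : (m.factorial : ℝ) ≤ (m : ℝ) ^ m := by exact_mod_cast Nat.factorial_le_pow m
  rw [mul_pow]
  exact h1.trans (mul_le_mul_of_nonneg_right h5
    (pow_nonneg (Finset.sum_nonneg fun i _ => hw i) _))

/-- For a Steinhaus sum of at most `m` terms, the `2m`-th moment is comparable to the `2m`-th power
of its maximum: the Cauchy–Schwarz inequality loses only the number of monomials of degree `m`. -/
lemma sum_pow_le_steinhausMoment {s : Finset ι} {m : ℕ} (hs : s.card ≤ m) (r : ι → ℝ) :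
    (∑ i ∈ s, r i) ^ (2 * m) ≤ 4 ^ m * steinhausMoment s (fun i => r i ^ 2) m := by
  classical
  rw [mul_comm 2 m, pow_mul, Finset.sum_pow_eq_sum_piAntidiag, steinhausMoment]
  refine sq_sum_le_card_mul_sum_sq.trans ?_
  have h1 : ((s.piAntidiag m).card : ℝ) ≤ 4 ^ m := by
    have : (s.piAntidiag m).card ≤ 4 ^ m := by
      refine (by convert Finset.card_piAntidiag_le s m : (s.piAntidiag m).card ≤ _).trans ?_
      rw [show (4 : ℕ) = 2 ^ 2 by norm_num, ← pow_mul]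
      exact Nat.pow_le_pow_right two_pos (by omega)
    exact_mod_cast this
  refine (mul_le_mul_of_nonneg_right h1 (Finset.sum_nonneg fun _ _ => sq_nonneg _)).trans_eq ?_
  congr 1
  refine Finset.sum_congr (by congr!) fun α _ => ?_
  rw [mul_pow, ← Finset.prod_pow]
  simp only [← pow_mul, mul_comm]

lemma Finset.succ_mul_sum_powersetCard_prod [DecidableEq ι] (s : Finset ι) (w : ι → ℝ) (k : ℕ) :
    (k + 1) * ∑ C ∈ s.powersetCard (k + 1), ∏ i ∈ C, w i =
      ∑ B ∈ s.powersetCard k, ∑ j ∈ s \ B, (∏ i ∈ B, w i) * w j := by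
  have h1 : (k + 1) * ∑ C ∈ s.powersetCard (k + 1), ∏ i ∈ C, w i =
      ∑ C ∈ s.powersetCard (k + 1), ∑ j ∈ C, ∏ i ∈ C, w i := by
    rw [Finset.mul_sum]
    refine Finset.sum_congr rfl fun C hC => ?_
    rw [Finset.sum_const, (Finset.mem_powersetCard.1 hC).2, nsmul_eq_mul]
    push_cast; ring
  rw [h1, Finset.sum_sigma', Finset.sum_sigma']
  refine Finset.sum_bij' (fun p _ => ⟨p.1.erase p.2, p.2⟩) (fun p _ => ⟨insert p.2 p.1, p.2⟩)
    ?_ ?_ ?_ ?_ ?_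
  · rintro ⟨C, j⟩ h
    simp only [Finset.mem_sigma, Finset.mem_powersetCard, Finset.mem_sdiff] at h ⊢
    obtain ⟨⟨h1, h2⟩, h3⟩ := h
    exact ⟨⟨(Finset.erase_subset _ _).trans h1, by rw [Finset.card_erase_of_mem h3, h2]; rfl⟩,
      h1 h3, Finset.notMem_erase _ _⟩
  · rintro ⟨B, j⟩ h
    simp only [Finset.mem_sigma, Finset.mem_powersetCard, Finset.mem_sdiff] at h ⊢
    obtain ⟨⟨h1, h2⟩, h3, h4⟩ := h
    exact ⟨⟨Finset.insert_subset h3 h1, by rw [Finset.card_insert_of_notMem h4, h2]⟩,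
      Finset.mem_insert_self _ _⟩
  · rintro ⟨C, j⟩ h
    simp only [Finset.mem_sigma] at h
    simp [Finset.insert_erase h.2]
  · rintro ⟨B, j⟩ h
    simp only [Finset.mem_sigma, Finset.mem_sdiff] at h
    simp [Finset.erase_insert h.2.2]
  · rintro ⟨C, j⟩ h
    simp only [Finset.mem_sigma] at h
    exact (Finset.prod_erase_mul C w h.2).symm

/-- If no weight exceeds the `m`-th part of the total weight, then the elementary symmetric
polynomials of degree `k ≤ m` are not much smaller than the corresponding power of the total. -/
lemma prod_le_factorial_mul_sum_powersetCard (s : Finset ι) {w : ι → ℝ} (hw : ∀ i, 0 ≤ w i)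
    {m : ℕ} (h : ∀ i ∈ s, m * w i ≤ ∑ j ∈ s, w j) {k : ℕ} (hk : k ≤ m) :
    m.descFactorial k * (∑ i ∈ s, w i) ^ k ≤
      m ^ k * (k.factorial * ∑ B ∈ s.powersetCard k, ∏ i ∈ B, w i) := by
  classical
  set W := ∑ i ∈ s, w i with hW
  have hW0 : 0 ≤ W := Finset.sum_nonneg fun i _ => hw i
  induction k with
  | zero => simp
  | succ k ih =>
    have ih := ih (by omega)
    set e := ∑ B ∈ s.powersetCard k, ∏ i ∈ B, w i
    have h1 : (m - k : ℝ) * W * e ≤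
        m * ((k + 1) * ∑ C ∈ s.powersetCard (k + 1), ∏ i ∈ C, w i) := by
      rw [Finset.succ_mul_sum_powersetCard_prod, Finset.mul_sum,
        Finset.mul_sum _ _ (m : ℝ)]
      refine Finset.sum_le_sum fun B hB => ?_
      obtain ⟨hB1, hB2⟩ := Finset.mem_powersetCard.1 hB
      rw [← Finset.mul_sum]
      have h2 : m * ∑ i ∈ B, w i ≤ k * W := by
        rw [Finset.mul_sum, ← hB2, ← nsmul_eq_mul]
        exact Finset.sum_le_card_nsmul B (fun i => (m : ℝ) * w i) W fun i hi => h i (hB1 hi)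
      have h3 : ∑ i ∈ s \ B, w i + ∑ i ∈ B, w i = W := Finset.sum_sdiff hB1
      have h4 : 0 ≤ ∏ i ∈ B, w i := Finset.prod_nonneg fun i _ => hw i
      calc (m - k : ℝ) * W * ∏ i ∈ B, w i
          ≤ (m * ∑ i ∈ s \ B, w i) * ∏ i ∈ B, w i :=
            mul_le_mul_of_nonneg_right (by rw [← h3] at h2 ⊢; linarith) h4
        _ = _ := by ring
    have h5 : (m.descFactorial (k + 1) : ℝ) = (m - k) * m.descFactorial k := by
      rw [Nat.descFactorial_succ]; push_cast [show k ≤ m by omega]; ring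
    have h6 : (0 : ℝ) ≤ m - k := by
      have : ((k : ℕ) : ℝ) ≤ m := by exact_mod_cast (by omega : k ≤ m)
      linarith
    rw [h5, Nat.factorial_succ]
    push_cast
    calc (m - k : ℝ) * m.descFactorial k * W ^ (k + 1)
        = ((m - k) * W) * (m.descFactorial k * W ^ k) := by ring
      _ ≤ ((m - k) * W) * (m ^ k * (k.factorial * e)) :=
          mul_le_mul_of_nonneg_left ih (by positivity)
      _ = m ^ k * k.factorial * ((m - k) * W * e) := by ring
      _ ≤ m ^ k * k.factorial * (m * ((k + 1) * ∑ C ∈ s.powersetCard (k + 1), ∏ i ∈ C, w i)) :=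
          mul_le_mul_of_nonneg_left h1 (by positivity)
      _ = _ := by ring

lemma factorial_sq_mul_sum_powersetCard_le (s : Finset ι) {w : ι → ℝ} (hw : ∀ i, 0 ≤ w i)
    (m : ℕ) :
    (m.factorial : ℝ) ^ 2 * ∑ B ∈ s.powersetCard m, ∏ i ∈ B, w i ≤ steinhausMoment s w m := by
  classical
  rw [Finset.mul_sum, steinhausMoment]
  -- Square-free monomials of degree `m` have multinomial coefficient `m!`.
  let φ : Finset ι → ι → ℕ := fun B i => if i ∈ B then 1 else 0
  have hφ : Function.Injective φ := by
    intro B C h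
    ext i
    have := congrFun h i
    simp only [φ] at this
    split_ifs at this <;> simp_all
  have h1 : ∀ B ∈ s.powersetCard m, φ B ∈ s.piAntidiag m ∧
      (m.factorial : ℝ) ^ 2 * ∏ i ∈ B, w i =
        (Nat.multinomial s (φ B) : ℝ) ^ 2 * ∏ i ∈ s, w i ^ φ B i := by
    intro B hB
    obtain ⟨hB1, hB2⟩ := Finset.mem_powersetCard.1 hB
    have hsum : ∑ i ∈ s, φ B i = m := by
      simp [φ, Finset.inter_eq_right.2 hB1, hB2]
    refine ⟨Finset.mem_piAntidiag.2 ⟨hsum, fun i hi => hB1 ?_⟩, ?_⟩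
    · by_contra h
      exact hi (if_neg h)
    · have h2 : Nat.multinomial s (φ B) = m.factorial := by
        have h3 : ∏ i ∈ s, (φ B i).factorial = 1 := Finset.prod_eq_one fun i _ => by
          simp only [φ]; split_ifs <;> rfl
        have := Nat.multinomial_spec s (φ B)
        rwa [h3, one_mul, hsum] at this
      rw [h2]
      congr 1
      rw [← Finset.prod_subset hB1]
      · exact Finset.prod_congr rfl fun i hi => by simp [φ, hi]
      · intro i _ hi
        simp [φ, hi]
  rw [Finset.sum_congr rfl fun B hB => (h1 B hB).2,
    ← Finset.sum_image (f := fun α => (Nat.multinomial s α : ℝ) ^ 2 * ∏ i ∈ s, w i ^ α i)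
      hφ.injOn]
  refine (Finset.sum_le_sum_of_subset_of_nonneg
    (Finset.image_subset_iff.2 fun B hB => (h1 B hB).1) fun α _ _ => ?_).trans_eq (by congr!)
  exact mul_nonneg (sq_nonneg _) (Finset.prod_nonneg fun i _ => pow_nonneg (hw i) _)

lemma pow_le_three_pow_mul_factorial (m : ℕ) : (m : ℝ) ^ m ≤ 3 ^ m * m.factorial := by
  have h1 := Real.pow_div_factorial_le_exp (m : ℝ) (Nat.cast_nonneg m) m
  rw [div_le_iff₀ (by positivity)] at h1
  refine h1.trans (mul_le_mul_of_nonneg_right ?_ (by positivity))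
  rw [← Real.exp_one_pow]
  exact pow_le_pow_left₀ (Real.exp_pos _).le (by linarith [Real.exp_one_lt_d9]) _

/-- The `2m`-th moment of a Steinhaus sum is of Gaussian size when no coefficient is large. -/
lemma pow_le_steinhausMoment (s : Finset ι) {w : ι → ℝ} (hw : ∀ i, 0 ≤ w i) {m : ℕ}
    (h : ∀ i ∈ s, m * w i ≤ ∑ j ∈ s, w j) :
    (m * ∑ i ∈ s, w i) ^ m ≤ 9 ^ m * steinhausMoment s w m := by
  have h1 := prod_le_factorial_mul_sum_powersetCard s hw h le_rfl
  rw [Nat.descFactorial_self] at h1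
  set W := ∑ i ∈ s, w i
  set e := ∑ B ∈ s.powersetCard m, ∏ i ∈ B, w i
  have he : 0 ≤ e := Finset.sum_nonneg fun B _ => Finset.prod_nonneg fun i _ => hw i
  have h2 : W ^ m ≤ m ^ m * e := by
    have hf : (0 : ℝ) < m.factorial := by positivity
    refine le_of_mul_le_mul_left (h1.trans_eq ?_) hf
    ring
  have h3 := pow_le_three_pow_mul_factorial m
  calc (m * W) ^ m = m ^ m * W ^ m := mul_pow _ _ _
    _ ≤ m ^ m * (m ^ m * e) := mul_le_mul_of_nonneg_left h2 (by positivity)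
    _ = (m ^ m) * (m ^ m) * e := by ring
    _ ≤ (3 ^ m * m.factorial) * (3 ^ m * m.factorial) * e := by gcongr
    _ = 9 ^ m * (m.factorial ^ 2 * e) := by
        rw [show (9 : ℝ) = 3 * 3 by norm_num, mul_pow]; ring
    _ ≤ _ := mul_le_mul_of_nonneg_left (factorial_sq_mul_sum_powersetCard_le s hw m) (by positivity)

end MomentBounds

/-! ### The nonincreasing rearrangement -/

section Rearrangement

/-- The layer cake formula for sums. -/
lemma tsum_eq_toReal_lintegral_encard {α : Type*} {w : α → ℝ} (hw : ∀ i, 0 ≤ w i) :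
    ∑' i, w i = (∫⁻ t in Set.Ioi (0 : ℝ), ({i | t < w i}.encard : ℝ≥0∞)).toReal := by
  let _ : MeasurableSpace α := ⊤
  have h1 := lintegral_eq_lintegral_meas_lt (f := w) Measure.count (.of_forall hw)
    measurable_from_top.aemeasurable
  rw [lintegral_count] at h1
  simp only [Measure.count_apply MeasurableSpace.measurableSet_top] at h1
  rw [← h1, ENNReal.tsum_toReal_eq fun _ => ENNReal.ofReal_ne_top]
  exact tsum_congr fun i => (ENNReal.toReal_ofReal (hw i)).symm

/-- Two nonnegative families with the same distribution function have the same sum. -/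
lemma tsum_eq_tsum_of_encard_eq {ι κ : Type*} {u : ι → ℝ} {v : κ → ℝ} (hu : ∀ i, 0 ≤ u i)
    (hv : ∀ j, 0 ≤ v j) (h : ∀ s, 0 ≤ s → {i | s < u i}.encard = {j | s < v j}.encard) :
    ∑' i, u i = ∑' j, v j := by
  rw [tsum_eq_toReal_lintegral_encard hu, tsum_eq_toReal_lintegral_encard hv]
  congr 1
  refine setLIntegral_congr_fun measurableSet_Ioi fun t ht => ?_
  rw [h t (le_of_lt ht)]

lemma ENat.encard_setOf_add_lt (N : ℕ) (E : ℕ∞) :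
    {n : ℕ | ((N + n : ℕ) : ℕ∞) < E}.encard = E - N := by
  induction E using ENat.recTopCoe with
  | top => simp
  | coe k =>
    have : {n : ℕ | ((N + n : ℕ) : ℕ∞) < k} = (Finset.range (k - N) : Set ℕ) := by
      ext n
      simp only [Set.mem_ofPred_eq, Nat.cast_lt, Finset.coe_range, Set.mem_Iio]
      omega
    rw [this, Set.encard_coe_eq_coe_finsetCard, Finset.card_range]
    rfl

lemma ENat.encard_setOf_lt_and_lt (N : ℕ) (E : ℕ∞) :
    {n : ℕ | n < N ∧ (n : ℕ∞) < E}.encard = min (N : ℕ∞) E := by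
  induction E using ENat.recTopCoe with
  | top =>
    have : {n : ℕ | n < N ∧ (n : ℕ∞) < ⊤} = (Finset.range N : Set ℕ) := by ext n; simp
    rw [this, Set.encard_coe_eq_coe_finsetCard, Finset.card_range]
    simp
  | coe k =>
    have : {n : ℕ | n < N ∧ (n : ℕ∞) < k} = (Finset.range (min N k) : Set ℕ) := by
      ext n; simp
    rw [this, Set.encard_coe_eq_coe_finsetCard, Finset.card_range]
    rfl

variable {ι : Type*} {a : ι → ℂ}

lemma rearrangement_nonneg (a : ι → ℂ) (n : ℕ) : 0 ≤ rearrangement a n :=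
  Real.sInf_nonneg fun _ hs => hs.1

/-- The rearrangement is the generalized inverse of the distribution function. -/
lemma lt_rearrangement_iff (ha : ∀ s, 0 < s → {i | s < ‖a i‖}.Finite) {s : ℝ} (hs : 0 ≤ s)
    (n : ℕ) : s < rearrangement a n ↔ (n : ℕ∞) < {i | s < ‖a i‖}.encard := by
  constructor
  · intro h
    by_contra! h'
    exact h.not_ge (csInf_le ⟨0, fun _ hu => hu.1⟩ ⟨hs, h'⟩)
  · intro h
    obtain ⟨B, hB, hBn⟩ := Set.exists_subset_encard_eq (Order.add_one_le_of_lt h)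
    have hBfin : B.Finite := Set.finite_of_encard_eq_coe (k := n + 1) (by simpa using hBn)
    have hBne : B.Nonempty := by
      rw [← Set.encard_ne_zero, hBn]; simp
    obtain ⟨i, hi, hmin⟩ := hBfin.exists_minimalFor (fun i => ‖a i‖) B hBne
    have hmin' : ∀ j ∈ B, ‖a i‖ ≤ ‖a j‖ := fun j hj =>
      (le_total ‖a i‖ ‖a j‖).elim id fun h => hmin hj h
    refine lt_of_lt_of_le (hB hi) (le_csInf ?_ ?_)
    · -- The infimum is over a nonempty set because `a` is bounded.
      obtain ⟨b, hb⟩ := ((ha 1 one_pos).image fun i => ‖a i‖).bddAbove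
      refine ⟨max b 1, by positivity, ?_⟩
      have : {i | max b 1 < ‖a i‖} = ∅ := by
        ext j
        simp only [Set.mem_ofPred_eq, Set.mem_empty_iff_false, iff_false, not_lt]
        by_contra! hj
        exact (hb ⟨j, (le_max_right _ _).trans_lt hj, rfl⟩).not_gt ((le_max_left _ _).trans_lt hj)
      rw [this]; simp
    · rintro u ⟨-, hu⟩
      by_contra! hlt
      have : B ⊆ {i | u < ‖a i‖} := fun j hj => hlt.trans_le (hmin' j hj)
      have := (Set.encard_le_encard this).trans hu
      rw [hBn] at this
      exact absurd this (not_le.2 (by exact_mod_cast Nat.lt_succ_self n))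

/-- `A` consists of the `N` largest terms of `a`, or contains all nonzero terms if there are
fewer than `N` of them. -/
structure IsTopSet (a : ι → ℂ) (N : ℕ) (A : Finset ι) : Prop where
  card_le : A.card ≤ N
  card_eq_or : A.card = N ∨ ∀ i ∉ A, a i = 0
  norm_le : ∀ i ∉ A, ∀ j ∈ A, ‖a i‖ ≤ ‖a j‖

lemma exists_isTopSet (ha : ∀ s, 0 < s → {i | s < ‖a i‖}.Finite) (N : ℕ) :
    ∃ A, IsTopSet a N A := by
  classical
  induction N with
  | zero => exact ⟨∅, by simp, by simp, by simp⟩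
  | succ N ih =>
    obtain ⟨A, hA⟩ := ih
    by_cases h0 : ∀ i ∉ A, a i = 0
    · exact ⟨A, hA.card_le.trans (Nat.le_succ N), .inr h0, hA.norm_le⟩
    push Not at h0
    obtain ⟨k, hk, hk0⟩ := h0
    have hpos : 0 < ‖a k‖ / 2 := by positivity
    obtain ⟨i, ⟨hi, hiA⟩, hmax⟩ := ((ha _ hpos).subset
      (Set.sep_subset {i | ‖a k‖ / 2 < ‖a i‖} (· ∉ A))).exists_maximalFor (fun i => ‖a i‖) _
      ⟨k, half_lt_self (norm_pos_iff.2 hk0), hk⟩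
    have hmax' : ∀ j ∉ A, ‖a j‖ ≤ ‖a i‖ := by
      intro j hj
      by_contra! hlt
      exact hlt.not_ge (hmax ⟨lt_trans hi hlt, hj⟩ hlt.le)
    have hcard : A.card = N := hA.card_eq_or.resolve_right fun h => hk0 (h k hk)
    refine ⟨insert i A, ?_, .inl ?_, ?_⟩
    · rw [Finset.card_insert_of_notMem hiA, hcard]
    · rw [Finset.card_insert_of_notMem hiA, hcard]
    · intro j hj l hl
      rw [Finset.mem_insert, not_or] at hj
      rcases Finset.mem_insert.1 hl with rfl | hl
      · exact hmax' j hj.2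
      · exact hA.norm_le j hj.2 l hl

lemma IsTopSet.subset_or {N : ℕ} {A : Finset ι} (hA : IsTopSet a N A) {s : ℝ} (hs : 0 ≤ s) :
    ({i | s < ‖a i‖} ⊆ A) ∨ (A.card = N ∧ ∀ j ∈ A, s < ‖a j‖) := by
  by_cases h : {i | s < ‖a i‖} ⊆ A
  · exact .inl h
  · obtain ⟨i, hi, hiA⟩ := Set.not_subset.1 h
    refine .inr ⟨hA.card_eq_or.resolve_right fun h0 => ?_,
      fun j hj => lt_of_lt_of_le hi (hA.norm_le i hiA j hj)⟩
    have : s < ‖a i‖ := hi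
    rw [h0 i hiA, norm_zero] at this
    exact this.not_ge hs

lemma IsTopSet.sum_rearrangement (ha : ∀ s, 0 < s → {i | s < ‖a i‖}.Finite) {N : ℕ}
    {A : Finset ι} (hA : IsTopSet a N A) :
    ∑ n ∈ Finset.range N, rearrangement a n = ∑ i ∈ A, ‖a i‖ := by
  classical
  have h1 : ∑' n, (if n < N then rearrangement a n else 0) =
      ∑' i, (if i ∈ A then ‖a i‖ else 0) := by
    refine tsum_eq_tsum_of_encard_eq ?_ ?_ fun s hs => ?_
    · intro n; split_ifs; exacts [rearrangement_nonneg a n, le_rfl]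
    · intro i; split_ifs <;> positivity
    · have e1 : {n | s < if n < N then rearrangement a n else 0} =
          {n | n < N ∧ (n : ℕ∞) < {i | s < ‖a i‖}.encard} := by
        ext n
        simp only [Set.mem_ofPred_eq]
        split_ifs with hn
        · simp [hn, lt_rearrangement_iff ha hs]
        · simp [hn, hs]
      have e2 : {i | s < if i ∈ A then ‖a i‖ else 0} = {i | s < ‖a i‖} ∩ A := by
        ext i
        simp only [Set.mem_ofPred_eq, Set.mem_inter_iff, Finset.mem_coe]
        split_ifs with hi
        · simp [hi]
        · simp [hi, hs]
      rw [e1, e2, ENat.encard_setOf_lt_and_lt]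
      rcases hA.subset_or hs with h | ⟨h, h'⟩
      · rw [Set.inter_eq_left.2 h, min_eq_right]
        refine (Set.encard_le_encard h).trans ?_
        rw [Set.encard_coe_eq_coe_finsetCard]
        exact_mod_cast hA.card_le
      · have h'' : (A : Set ι) ⊆ {i | s < ‖a i‖} := h'
        rw [Set.inter_eq_right.2 h'', min_eq_left, Set.encard_coe_eq_coe_finsetCard, h]
        refine le_trans ?_ (Set.encard_le_encard h'')
        rw [Set.encard_coe_eq_coe_finsetCard, h]
  rw [tsum_eq_sum (s := Finset.range N) (by intro n hn; simp_all),
    tsum_eq_sum (s := A) (by intro n hn; simp_all)] at h1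
  rw [Finset.sum_congr rfl fun n hn => (if_pos (Finset.mem_range.1 hn)).symm, h1]
  exact Finset.sum_congr rfl fun i hi => if_pos hi

open Classical in
lemma IsTopSet.tsum_rearrangement_sq (ha : ∀ s, 0 < s → {i | s < ‖a i‖}.Finite) {N : ℕ}
    {A : Finset ι} (hA : IsTopSet a N A) :
    ∑' n, rearrangement a (N + n) ^ 2 = ∑' i, (if i ∈ A then 0 else ‖a i‖ ^ 2) := by
  refine tsum_eq_tsum_of_encard_eq (fun n => sq_nonneg _)
    (fun i => by split_ifs <;> positivity) fun s hs => ?_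
  have hs' := Real.sqrt_nonneg s
  have e1 : {n | s < rearrangement a (N + n) ^ 2} =
      {n : ℕ | ((N + n : ℕ) : ℕ∞) < {i | √s < ‖a i‖}.encard} := by
    ext n
    simp only [Set.mem_ofPred_eq]
    rw [← lt_rearrangement_iff ha hs', Real.sqrt_lt hs (rearrangement_nonneg _ _)]
  have e2 : {i | s < if i ∈ A then 0 else ‖a i‖ ^ 2} = {i | √s < ‖a i‖} \ A := by
    ext i
    simp only [Set.mem_ofPred_eq, Set.mem_sdiff, Finset.mem_coe]
    split_ifs with hi
    · simp [hi, hs]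
    · simp [hi, Real.sqrt_lt hs (norm_nonneg _)]
  rw [e1, e2, ENat.encard_setOf_add_lt]
  rcases hA.subset_or hs' with h | ⟨h, h'⟩
  · rw [Set.sdiff_eq_empty.2 h, Set.encard_empty, tsub_eq_zero_iff_le]
    refine (Set.encard_le_encard h).trans ?_
    rw [Set.encard_coe_eq_coe_finsetCard]
    exact_mod_cast hA.card_le
  · have h'' : (A : Set ι) ⊆ {i | √s < ‖a i‖} := h'
    rw [← Set.encard_sdiff_add_encard_of_subset h'', Set.encard_coe_eq_coe_finsetCard, h]
    exact (ENat.addLECancellable_of_ne_top (ENat.natCast_ne_top N)).add_tsub_cancel_right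

open Classical in
lemma IsTopSet.K12_eq (ha : ∀ s, 0 < s → {i | s < ‖a i‖}.Finite) {t : ℝ} {A : Finset ι}
    (hA : IsTopSet a ⌊t ^ 2⌋₊ A) :
    K12 a t = ∑ i ∈ A, ‖a i‖ + t * √(∑' i, if i ∈ A then 0 else ‖a i‖ ^ 2) := by
  rw [K12, hA.sum_rearrangement ha, hA.tsum_rearrangement_sq ha]

end Rearrangement

/-! ### Tails of Sidon polynomials -/

section FiniteTails

variable {G : Type*} [CommGroup G] [TopologicalSpace G] {ι : Type*} {γ : ι → PontryaginDual G}

lemma norm_trigPoly_apply_le (γ : ι → PontryaginDual G) (s : Finset ι) (a : ι → ℂ) (x : G) :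
    ‖trigPoly γ s a x‖ ≤ ∑ i ∈ s, ‖a i‖ := by
  rw [trigPoly_apply]
  refine (norm_sum_le _ _).trans_eq (Finset.sum_congr rfl fun i _ => ?_)
  rw [norm_mul, norm_characterFun_apply, mul_one]

open Classical in
lemma norm_trigPoly_apply_le_add (γ : ι → PontryaginDual G) {s t : Finset ι} (hst : s ⊆ t)
    (a : ι → ℂ) (x : G) :
    ‖trigPoly γ t a x‖ ≤ ∑ i ∈ s, ‖a i‖ + ‖trigPoly γ (t \ s) a x‖ := by
  have : trigPoly γ t a x = trigPoly γ s a x + trigPoly γ (t \ s) a x := by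
    simp only [trigPoly_apply]
    rw [add_comm, Finset.sum_sdiff hst]
  rw [this]
  exact (norm_add_le _ _).trans (add_le_add_left (norm_trigPoly_apply_le γ s a x) _)

variable [Countable ι] [IsTopologicalGroup G] [CompactSpace G] [MeasurableSpace G] [BorelSpace G]
  (μ : Measure G) [μ.IsHaarMeasure] [IsProbabilityMeasure μ] {R : ℝ}

/-- Rudin's inequality: `‖f‖_{2m} ≤ R √m ‖f‖_2` for `f` with spectrum in a Sidon set. -/
lemma SidonBound.integral_pow_le (hγ : Function.Injective γ) (hR : 1 ≤ R)
    (h : SidonBound μ (Set.range γ) R) (s : Finset ι) (a : ι → ℂ) {m : ℕ} (hm : 1 ≤ m) :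
    ∫ x, ‖trigPoly γ s a x‖ ^ (2 * m) ∂μ ≤ R ^ (2 * m) * (m * ∑ i ∈ s, ‖a i‖ ^ 2) ^ m :=
  (h.integral_le_steinhausMoment μ hγ (zero_le_one.trans hR) s a hm).trans
    (mul_le_mul_of_nonneg_left (steinhausMoment_le s (fun i => sq_nonneg _) m) (by positivity))

open Classical in
lemma SidonBound.integral_pow_le_of_subset (hγ : Function.Injective γ) (hR : 1 ≤ R)
    (h : SidonBound μ (Set.range γ) R) {A T : Finset ι} (hAT : A ⊆ T) (a : ι → ℂ) {m : ℕ}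
    (hm : 1 ≤ m) :
    ∫ x, ‖trigPoly γ T a x‖ ^ (2 * m) ∂μ ≤
      (2 * R * (∑ i ∈ A, ‖a i‖ + √(m * ∑ i ∈ T \ A, ‖a i‖ ^ 2))) ^ (2 * m) := by
  set l := ∑ i ∈ A, ‖a i‖
  set V := ∑ i ∈ T \ A, ‖a i‖ ^ 2
  have hl : 0 ≤ l := Finset.sum_nonneg fun i _ => norm_nonneg _
  have hV : 0 ≤ m * V := mul_nonneg (Nat.cast_nonneg m) (Finset.sum_nonneg fun i _ => sq_nonneg _)
  have h1 : ∀ x, ‖trigPoly γ T a x‖ ^ (2 * m) ≤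
      2 ^ (2 * m) * (l ^ (2 * m) + ‖trigPoly γ (T \ A) a x‖ ^ (2 * m)) := fun x => by
    refine (pow_le_pow_left₀ (norm_nonneg _) (norm_trigPoly_apply_le_add γ hAT a x) _).trans ?_
    refine (add_pow_le hl (norm_nonneg _) _).trans (mul_le_mul_of_nonneg_right ?_ (by positivity))
    exact pow_le_pow_right₀ one_le_two (Nat.sub_le _ _)
  have h2 := integral_mono (μ := μ) (integrable_of_continuous μ (by fun_prop))
    (integrable_of_continuous μ (by fun_prop)) h1
  rw [integral_const_mul, integral_add (integrable_const _)
    (integrable_of_continuous μ (by fun_prop)), integral_const] at h2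
  simp only [probReal_univ, one_smul] at h2
  refine h2.trans ?_
  rw [mul_assoc, mul_pow]
  refine mul_le_mul_of_nonneg_left ?_ (by positivity)
  have h3 := h.integral_pow_le μ hγ hR (T \ A) a hm
  have h4 : (m * V) ^ m = √(m * V) ^ (2 * m) := by rw [pow_mul, Real.sq_sqrt hV]
  rw [h4] at h3
  calc l ^ (2 * m) + ∫ x, ‖trigPoly γ (T \ A) a x‖ ^ (2 * m) ∂μ
      ≤ R ^ (2 * m) * l ^ (2 * m) + R ^ (2 * m) * √(m * V) ^ (2 * m) :=
        add_le_add (le_mul_of_one_le_left (by positivity) (one_le_pow₀ hR)) h3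
    _ = R ^ (2 * m) * (l ^ (2 * m) + √(m * V) ^ (2 * m)) := by ring
    _ ≤ R ^ (2 * m) * (l + √(m * V)) ^ (2 * m) := mul_le_mul_of_nonneg_left
        (pow_add_pow_le hl (Real.sqrt_nonneg _) (by omega)) (by positivity)
    _ = _ := (mul_pow _ _ _).symm

open Classical in
/-- The lower moment bound. If the head `A` dominates, the Steinhaus sum over `A` is large;
otherwise all coefficients of the tail are small compared with its `ℓ²` norm and the tail behaves
like a Gaussian variable. -/
lemma SidonBound.le_integral_pow (hγ : Function.Injective γ) (hR : 1 ≤ R)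
    (h : SidonBound μ (Set.range γ) R) {A T : Finset ι} (hAT : A ⊆ T) (a : ι → ℂ) {m : ℕ}
    (hm : 1 ≤ m) (hA : IsTopSet a m A) :
    ((∑ i ∈ A, ‖a i‖ + √(m * ∑ i ∈ T \ A, ‖a i‖ ^ 2)) / (6 * R)) ^ (2 * m) ≤
      ∫ x, ‖trigPoly γ T a x‖ ^ (2 * m) ∂μ := by
  have hR0 : 0 < R := zero_lt_one.trans_le hR
  set l := ∑ i ∈ A, ‖a i‖ with hl_def
  set V := ∑ i ∈ T \ A, ‖a i‖ ^ 2 with hV_def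
  set q := √(m * V) with hq
  have hl : 0 ≤ l := Finset.sum_nonneg fun i _ => norm_nonneg _
  have hV : 0 ≤ m * V := mul_nonneg (Nat.cast_nonneg m) (Finset.sum_nonneg fun i _ => sq_nonneg _)
  have hq0 : 0 ≤ q := Real.sqrt_nonneg _
  have key : ∀ (y : ℝ) (s : Finset ι), l + q ≤ 6 * y → s ⊆ T →
      y ^ (2 * m) ≤ steinhausMoment s (fun i => ‖a i‖ ^ 2) m →
      ((l + q) / (6 * R)) ^ (2 * m) ≤ ∫ x, ‖trigPoly γ T a x‖ ^ (2 * m) ∂μ := by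
    intro y s hy hs hM
    have h1 := hM.trans (h.steinhausMoment_le_integral μ hγ hR0.le hs a hm)
    have h2 : (l + q) / (6 * R) ≤ y / R := by
      rw [div_le_div_iff₀ (by positivity) hR0]
      nlinarith
    refine (pow_le_pow_left₀ (by positivity) h2 _).trans ?_
    rw [div_pow, div_le_iff₀ (by positivity)]
    exact h1.trans_eq (mul_comm _ _)
  rcases le_or_gt q l with hql | hql
  · refine key (l / 2) A (by linarith) hAT ?_
    have := sum_pow_le_steinhausMoment hA.card_le fun i => ‖a i‖
    rw [div_pow, div_le_iff₀ (by positivity), pow_mul 2 2 m]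
    norm_num1
    exact this.trans_eq (mul_comm _ _)
  · refine key (q / 3) (T \ A) (by linarith) Finset.sdiff_subset ?_
    have hlt : l ^ 2 < m * V := by
      rw [← Real.sq_sqrt hV]
      exact pow_lt_pow_left₀ hql hl two_ne_zero
    have hm0 : (0 : ℝ) < m := by exact_mod_cast hm
    have := pow_le_steinhausMoment (T \ A) (w := fun i => ‖a i‖ ^ 2) (fun i => sq_nonneg _)
      (m := m) fun i hi => by
        have hiA := (Finset.mem_sdiff.1 hi).2
        have h1 : m * ‖a i‖ ≤ l := by
          rcases hA.card_eq_or with hc | h0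
          · rw [hl_def, ← hc, ← nsmul_eq_mul]
            exact Finset.card_nsmul_le_sum A _ _ fun j hj => hA.norm_le i hiA j hj
          · rw [h0 i hiA, norm_zero, mul_zero]; exact hl
        have h2 : (m * ‖a i‖) ^ 2 ≤ m * V :=
          (pow_le_pow_left₀ (by positivity) h1 2).trans hlt.le
        refine le_of_mul_le_mul_left (h2.trans' (le_of_eq ?_)) hm0
        ring
    rw [div_pow, div_le_iff₀ (by positivity), pow_mul 3 2 m, pow_mul q, hq,
      Real.sq_sqrt hV]
    norm_num1
    exact this.trans_eq (mul_comm _ _)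

/-- The Paley–Zygmund inequality. -/
lemma paley_zygmund {X : Type*} [TopologicalSpace X] [CompactSpace X] [MeasurableSpace X]
    [BorelSpace X] (μ : Measure X) [IsProbabilityMeasure μ] {Y : X → ℝ} (hY : Continuous Y)
    (hY0 : 0 ≤ Y) :
    (∫ x, Y x ∂μ) ^ 2 ≤ 4 * (∫ x, Y x ^ 2 ∂μ) * μ.real {x | (∫ x, Y x ∂μ) / 2 ≤ Y x} := by
  set E := ∫ x, Y x ∂μ with hE
  set B := {x | E / 2 ≤ Y x}
  have hB : MeasurableSet B := measurableSet_le measurable_const hY.measurable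
  have hE0 : 0 ≤ E := integral_nonneg hY0
  have hYi : Integrable Y μ := integrable_of_continuous μ hY
  have hmem : MemLp Y 2 μ := hY.memLp_of_hasCompactSupport (HasCompactSupport.of_compactSpace _)
  have h1 : E ≤ E / 2 + ∫ x, Y x * B.indicator 1 x ∂μ := by
    have hi : Integrable (fun x => Y x * B.indicator 1 x) μ := by
      refine (hYi.indicator hB).congr (.of_forall fun x => ?_)
      by_cases hx : x ∈ B <;> simp [hx]
    have : ∀ x, Y x ≤ E / 2 + Y x * B.indicator 1 x := by
      intro x
      by_cases hx : x ∈ B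
      · simp only [Set.indicator_of_mem hx, Pi.one_apply, mul_one]; linarith
      · simp only [Set.indicator_of_notMem hx, mul_zero, add_zero]
        exact (not_le.1 hx).le
    have h2 := integral_mono (μ := μ) hYi ((integrable_const _).add hi) this
    rw [integral_add' (integrable_const _) hi, integral_const] at h2
    simpa using h2
  have hind : MemLp (B.indicator (1 : X → ℝ)) 2 μ := by
    exact (memLp_const (1 : ℝ)).indicator hB
  have h3 := integral_mul_le_Lp_mul_Lq_of_nonneg (μ := μ) Real.HolderConjugate.two_two
    (f := Y) (g := B.indicator 1) (.of_forall hY0)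
    (.of_forall fun x => Set.indicator_nonneg (fun _ _ => zero_le_one) x)
    (by simpa using hmem) (by simpa using hind)
  have h4 : ∫ x, (B.indicator (1 : X → ℝ) x) ^ (2 : ℝ) ∂μ = μ.real B := by
    rw [← integral_indicator_one hB]
    refine integral_congr_ae (.of_forall fun x => ?_)
    by_cases hx : x ∈ B <;> simp [hx]
  rw [h4] at h3
  simp only [Real.rpow_two, ← Real.sqrt_eq_rpow] at h3
  have h5 : E ≤ 2 * (√(∫ x, Y x ^ 2 ∂μ) * √(μ.real B)) := by linarith
  refine (pow_le_pow_left₀ hE0 h5 2).trans_eq ?_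
  rw [mul_pow, mul_pow, Real.sq_sqrt (integral_nonneg fun x => sq_nonneg _),
    Real.sq_sqrt measureReal_nonneg]
  ring

open Classical in
/-- The lower tail bound for polynomials. -/
lemma SidonBound.le_measureReal (hγ : Function.Injective γ) (hR : 1 ≤ R)
    (h : SidonBound μ (Set.range γ) R) {A T : Finset ι} (hAT : A ⊆ T) (a : ι → ℂ) {m : ℕ}
    (hm : 1 ≤ m) (hA : IsTopSet a m A)
    (hL : 0 < ∑ i ∈ A, ‖a i‖ + √(m * ∑ i ∈ T \ A, ‖a i‖ ^ 2)) :
    (4 * (24 * R ^ 2) ^ (4 * m))⁻¹ ≤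
      μ.real {x | (∑ i ∈ A, ‖a i‖ + √(m * ∑ i ∈ T \ A, ‖a i‖ ^ 2)) / (12 * R) ≤
        ‖trigPoly γ T a x‖} := by
  have hR0 : 0 < R := zero_lt_one.trans_le hR
  set l := ∑ i ∈ A, ‖a i‖
  set V := ∑ i ∈ T \ A, ‖a i‖ ^ 2
  set L := l + √(m * V) with hLdef
  have hl : 0 ≤ l := Finset.sum_nonneg fun i _ => norm_nonneg _
  have h1 := h.le_integral_pow μ hγ hR hAT a hm hA
  have h2 := h.integral_pow_le_of_subset μ hγ hR hAT a (m := 2 * m) (by omega)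
  have hpz := paley_zygmund μ (Y := fun x => ‖trigPoly γ T a x‖ ^ (2 * m)) (by fun_prop)
    (fun x => by positivity)
  simp only [← pow_mul] at hpz
  rw [show 2 * m * 2 = 2 * (2 * m) by ring] at hpz
  set E := ∫ x, ‖trigPoly γ T a x‖ ^ (2 * m) ∂μ
  set F := ∫ x, ‖trigPoly γ T a x‖ ^ (2 * (2 * m)) ∂μ
  have h3 : F ≤ (4 * R * L) ^ (4 * m) := by
    refine h2.trans ?_
    rw [show 2 * (2 * m) = 4 * m by ring]
    refine pow_le_pow_left₀ (by positivity) ?_ _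
    have : √(((2 * m : ℕ) : ℝ) * V) ≤ 2 * √(m * V) := by
      push_cast
      rw [mul_assoc, Real.sqrt_mul zero_le_two]
      refine mul_le_mul_of_nonneg_right ?_ (Real.sqrt_nonneg _)
      rw [Real.sqrt_le_left zero_le_two]; norm_num
    calc 2 * R * (l + √(((2 * m : ℕ) : ℝ) * V)) ≤ 2 * R * (2 * l + 2 * √(m * V)) :=
          mul_le_mul_of_nonneg_left (by linarith) (by positivity)
      _ = 4 * R * L := by rw [hLdef]; ring
  have h4 : (L / (6 * R)) ^ (4 * m) ≤ E ^ 2 := by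
    rw [show 4 * m = 2 * m * 2 by ring, pow_mul _ (2 * m) 2]
    exact pow_le_pow_left₀ (by positivity) h1 2
  have hsub : μ.real {x | E / 2 ≤ ‖trigPoly γ T a x‖ ^ (2 * m)} ≤
      μ.real {x | L / (12 * R) ≤ ‖trigPoly γ T a x‖} := by
    refine measureReal_mono fun x (hx : E / 2 ≤ _) => ?_
    have h5 : (L / (12 * R)) ^ (2 * m) ≤ ‖trigPoly γ T a x‖ ^ (2 * m) := by
      refine le_trans ?_ (le_trans (div_le_div_of_nonneg_right h1 zero_le_two) hx)
      rw [show L / (12 * R) = L / (6 * R) / 2 by field_simp; norm_num, div_pow _ (2 : ℝ)]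
      exact div_le_div_of_nonneg_left (by positivity) two_pos
        (le_self_pow₀ one_le_two (by omega))
    exact (pow_le_pow_iff_left₀ (by positivity) (norm_nonneg _) (by omega)).1 h5
  refine le_trans ?_ hsub
  set P := μ.real {x | E / 2 ≤ ‖trigPoly γ T a x‖ ^ (2 * m)}
  have hP : 0 ≤ P := measureReal_nonneg
  have h6 : (L / (6 * R)) ^ (4 * m) ≤ 4 * (4 * R * L) ^ (4 * m) * P :=
    h4.trans (hpz.trans (by gcongr))
  rw [inv_le_iff_one_le_mul₀ (by positivity)]
  have h7 : (4 * R * L) ^ (4 * m) = (24 * R ^ 2) ^ (4 * m) * (L / (6 * R)) ^ (4 * m) := by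
    rw [← mul_pow]; congr 1; field_simp; norm_num
  rw [h7] at h6
  have h8 : 0 < (L / (6 * R)) ^ (4 * m) := by positivity
  refine le_of_mul_le_mul_right ?_ h8
  linarith

open Classical in
/-- The upper tail bound for polynomials, by Chebyshev's inequality for the `2m`-th moment of the
tail of the coefficients. -/
lemma SidonBound.measureReal_le (hγ : Function.Injective γ) (hR : 1 ≤ R)
    (h : SidonBound μ (Set.range γ) R) {A T : Finset ι} (hAT : A ⊆ T) (a : ι → ℂ) {m : ℕ}
    (hm : 1 ≤ m) {y : ℝ} (hy : 0 < y) (hyV : (3 * R) ^ 2 * (m * ∑ i ∈ T \ A, ‖a i‖ ^ 2) ≤ y ^ 2) :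
    μ.real {x | ∑ i ∈ A, ‖a i‖ + y ≤ ‖trigPoly γ T a x‖} ≤ Real.exp (-(2 * m)) := by
  have hR0 : 0 < R := zero_lt_one.trans_le hR
  set V := ∑ i ∈ T \ A, ‖a i‖ ^ 2
  have hV : 0 ≤ m * V := mul_nonneg (Nat.cast_nonneg m) (Finset.sum_nonneg fun i _ => sq_nonneg _)
  have h1 : μ.real {x | ∑ i ∈ A, ‖a i‖ + y ≤ ‖trigPoly γ T a x‖} ≤
      μ.real {x | y ^ (2 * m) ≤ ‖trigPoly γ (T \ A) a x‖ ^ (2 * m)} := by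
    refine measureReal_mono fun x hx => ?_
    have hx' : ∑ i ∈ A, ‖a i‖ + y ≤ ‖trigPoly γ T a x‖ := hx
    refine pow_le_pow_left₀ hy.le ?_ _
    linarith [norm_trigPoly_apply_le_add γ hAT a x]
  refine h1.trans ?_
  have h2 := mul_meas_ge_le_integral_of_nonneg (μ := μ)
    (f := fun x => ‖trigPoly γ (T \ A) a x‖ ^ (2 * m)) (.of_forall fun x => by positivity)
    (integrable_of_continuous μ (by fun_prop)) (y ^ (2 * m))
  have h3 := h2.trans (h.integral_pow_le μ hγ hR (T \ A) a hm)
  have h4 : R ^ (2 * m) * (m * V) ^ m ≤ y ^ (2 * m) * (1 / 9) ^ m := by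
    rw [pow_mul, pow_mul, ← mul_pow, ← mul_pow]
    refine pow_le_pow_left₀ (by positivity) ?_ _
    linarith
  have h5 := le_of_mul_le_mul_left (h3.trans h4) (by positivity)
  refine h5.trans ?_
  rw [Real.exp_neg, mul_comm, Real.exp_nat_mul, one_div, inv_pow]
  refine inv_anti₀ (by positivity) (pow_le_pow_left₀ (by positivity) ?_ _)
  have := Real.exp_one_lt_d9
  rw [show (2 : ℝ) = 1 + 1 by norm_num, Real.exp_add]
  nlinarith [Real.exp_pos 1]

end FiniteTails

/-! ### Tails of Sidon series -/

section Limits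

open Filter Topology

variable {X κ : Type*} [MeasurableSpace X] {μ : Measure X} [IsFiniteMeasure μ]

lemma measureReal_le_add_of_norm_sub (g g' : X → ℂ) (r : ℝ) :
    μ.real {x | r ≤ ‖g x‖} ≤ μ.real {x | r / 2 ≤ ‖g' x‖} + μ.real {x | r / 2 ≤ ‖g x - g' x‖} := by
  refine le_trans (measureReal_mono fun x hx => ?_) (measureReal_union_le _ _)
  by_contra hcon
  simp only [Set.mem_union, Set.mem_ofPred_eq, not_or, not_le] at hcon hx
  have := norm_sub_norm_le (g x) (g' x)
  linarith

/-- Lower bounds for tails pass to limits in measure, at half the level. -/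
lemma le_measureReal_of_tendstoInMeasure {w : κ → X → ℂ} {l : Filter κ} [NeBot l] {f : X → ℂ}
    (hw : TendstoInMeasure μ w l f) {r p : ℝ} (hr : 0 < r)
    (h : ∀ᶠ k in l, p ≤ μ.real {x | r ≤ ‖w k x‖}) : p ≤ μ.real {x | r / 2 ≤ ‖f x‖} := by
  have h1 := (tendstoInMeasure_iff_measureReal_norm.1 hw (r / 2) (half_pos hr)).const_add
    (μ.real {x | r / 2 ≤ ‖f x‖})
  rw [add_zero] at h1
  exact ge_of_tendsto h1 (h.mono fun k hk => hk.trans (measureReal_le_add_of_norm_sub _ _ r))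

/-- Upper bounds for tails pass to limits in measure, at twice the level. -/
lemma measureReal_le_of_tendstoInMeasure {w : κ → X → ℂ} {l : Filter κ} [NeBot l] {f : X → ℂ}
    (hw : TendstoInMeasure μ w l f) {r p : ℝ} (hr : 0 < r)
    (h : ∀ᶠ k in l, μ.real {x | r / 2 ≤ ‖w k x‖} ≤ p) : μ.real {x | r ≤ ‖f x‖} ≤ p := by
  have h1 := (tendstoInMeasure_iff_measureReal_norm.1 hw (r / 2) (half_pos hr)).const_add p
  rw [add_zero] at h1
  refine ge_of_tendsto h1 (h.mono fun k hk => ?_)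
  refine (measureReal_le_add_of_norm_sub _ (w k) r).trans (add_le_add hk (le_of_eq ?_))
  simp only [norm_sub_rev]

end Limits

section SidonSeries

open Filter Topology

variable {ι : Type*} {a : ι → ℂ}

lemma finite_setOf_lt_norm (ha : Summable fun i => ‖a i‖ ^ 2) {s : ℝ} (hs : 0 < s) :
    {i | s < ‖a i‖}.Finite := by
  have h := ha.tendsto_cofinite_zero.eventually (gt_mem_nhds (pow_pos hs 2))
  refine (Filter.eventually_cofinite.1 h).subset fun i (hi : s < ‖a i‖) => ?_
  exact not_lt.2 (pow_le_pow_left₀ hs.le hi.le 2)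

open Classical in
lemma summable_ite_sq (ha : Summable fun i => ‖a i‖ ^ 2) (A : Finset ι) :
    Summable fun i => if i ∈ A then 0 else ‖a i‖ ^ 2 :=
  ha.of_nonneg_of_le (fun i => by split_ifs <;> positivity)
    (fun i => by split_ifs; exacts [sq_nonneg _, le_rfl])

open Classical in
lemma tendsto_sum_sdiff_sq (ha : Summable fun i => ‖a i‖ ^ 2) (A : Finset ι) :
    Tendsto (fun T => ∑ i ∈ T \ A, ‖a i‖ ^ 2) atTop
      (𝓝 (∑' i, if i ∈ A then 0 else ‖a i‖ ^ 2)) := by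
  have h := summable_ite_sq ha A
  refine h.hasSum.congr fun T => ?_
  rw [Finset.sum_ite, Finset.sum_const_zero, zero_add, Finset.sdiff_eq_filter]

open Classical in
lemma sum_sdiff_sq_le_tsum (ha : Summable fun i => ‖a i‖ ^ 2) (A T : Finset ι) :
    ∑ i ∈ T \ A, ‖a i‖ ^ 2 ≤ ∑' i, if i ∈ A then 0 else ‖a i‖ ^ 2 := by
  have h := summable_ite_sq ha A
  refine le_trans (le_of_eq ?_) (h.sum_le_tsum (T \ A) fun i _ => by split_ifs <;> positivity)
  exact Finset.sum_congr rfl fun i hi => by rw [if_neg (Finset.mem_sdiff.1 hi).2]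

lemma K12_pos (ha : Summable fun i => ‖a i‖ ^ 2) (ha0 : a ≠ 0) {t : ℝ} (ht : 0 < t) :
    0 < K12 a t := by
  classical
  have hfin := fun s (hs : (0 : ℝ) < s) => finite_setOf_lt_norm ha hs
  obtain ⟨A, hA⟩ := exists_isTopSet hfin ⌊t ^ 2⌋₊
  rw [hA.K12_eq hfin]
  obtain ⟨i, hi⟩ := Function.ne_iff.1 ha0
  have hi' : 0 < ‖a i‖ := norm_pos_iff.2 hi
  have h0 : 0 ≤ ∑ j ∈ A, ‖a j‖ := Finset.sum_nonneg fun _ _ => norm_nonneg _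
  by_cases hiA : i ∈ A
  · have := Finset.single_le_sum (f := fun j => ‖a j‖) (fun _ _ => norm_nonneg _) hiA
    have : 0 < ∑ j ∈ A, ‖a j‖ := hi'.trans_le this
    positivity
  · have h1 := sum_sdiff_sq_le_tsum ha A {i}
    rw [Finset.sdiff_eq_self_of_disjoint (by simpa using hiA), Finset.sum_singleton] at h1
    have : 0 < √(∑' i, if i ∈ A then 0 else ‖a i‖ ^ 2) :=
      Real.sqrt_pos.2 ((pow_pos hi' 2).trans_le h1)
    positivity

open Classical in
/-- With `m = max 1 ⌊t²⌋`, the head and tail of `a` at `m` control `K12 a t`. For `t < 1` the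
functional is `t ‖a‖₂`, while the moments used start from the second. -/
lemma K12_le_of_isTopSet (ha : Summable fun i => ‖a i‖ ^ 2) {t : ℝ} (ht : 0 < t) {A : Finset ι}
    (hA : IsTopSet a (max 1 ⌊t ^ 2⌋₊) A) :
    K12 a t ≤ 2 * (∑ i ∈ A, ‖a i‖ +
      √((max 1 ⌊t ^ 2⌋₊ : ℕ) * ∑' i, if i ∈ A then 0 else ‖a i‖ ^ 2)) := by
  have hfin := fun s (hs : (0 : ℝ) < s) => finite_setOf_lt_norm ha hs
  have hW0 : 0 ≤ ∑' i, (if i ∈ A then 0 else ‖a i‖ ^ 2) :=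
    tsum_nonneg fun i => by split_ifs <;> positivity
  have hl0 : 0 ≤ ∑ i ∈ A, ‖a i‖ := Finset.sum_nonneg fun _ _ => norm_nonneg _
  rcases lt_or_ge t 1 with h1 | h1
  · have hfl : ⌊t ^ 2⌋₊ = 0 := Nat.floor_eq_zero.2 (pow_lt_one₀ ht.le h1 two_ne_zero)
    have h0 : IsTopSet a ⌊t ^ 2⌋₊ ∅ := by rw [hfl]; exact ⟨by simp, by simp, by simp⟩
    rw [h0.K12_eq hfin, hfl]
    simp only [Finset.sum_empty, zero_add, Finset.notMem_empty, if_false, zero_le_one,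
      max_eq_left, Nat.cast_one, one_mul]
    have h2 : ∑' i, ‖a i‖ ^ 2 = ∑ i ∈ A, ‖a i‖ ^ 2 + ∑' i, if i ∈ A then 0 else ‖a i‖ ^ 2 := by
      rw [← ha.sum_add_tsum_compl (s := A), tsum_subtype ((A : Set ι)ᶜ) fun i => ‖a i‖ ^ 2]
      congr 1
      refine tsum_congr fun i => ?_
      by_cases hi : i ∈ A <;> simp [hi]
    set W := ∑' i, if i ∈ A then 0 else ‖a i‖ ^ 2
    have h3 : √(∑' i, ‖a i‖ ^ 2) ≤ ∑ i ∈ A, ‖a i‖ + √W := by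
      rw [Real.sqrt_le_left (by positivity), h2]
      have h4 : ∑ i ∈ A, ‖a i‖ ^ 2 ≤ (∑ i ∈ A, ‖a i‖) ^ 2 :=
        Finset.sum_sq_le_sq_sum_of_nonneg fun _ _ => norm_nonneg _
      have h5 := Real.sq_sqrt hW0
      have h6 : 0 ≤ (∑ i ∈ A, ‖a i‖) * √W := by positivity
      nlinarith
    have h7 : t * √(∑' i, ‖a i‖ ^ 2) ≤ √(∑' i, ‖a i‖ ^ 2) :=
      mul_le_of_le_one_left (Real.sqrt_nonneg _) h1.le
    have h8 : 0 ≤ ∑ i ∈ A, ‖a i‖ + √W := by positivity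
    linarith
  · have hN : 1 ≤ ⌊t ^ 2⌋₊ := Nat.le_floor (by exact_mod_cast one_le_pow₀ h1)
    rw [max_eq_right hN] at hA ⊢
    rw [hA.K12_eq hfin]
    set N := ⌊t ^ 2⌋₊
    set W := ∑' i, if i ∈ A then 0 else ‖a i‖ ^ 2
    have htN : t ^ 2 < N + 1 := Nat.lt_floor_add_one _
    have hN' : (1 : ℝ) ≤ N := by exact_mod_cast hN
    have h2 : t ≤ 2 * √N := by
      refine le_of_sq_le_sq ?_ (by positivity)
      rw [mul_pow, Real.sq_sqrt (by positivity)]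
      linarith
    have h3 : t * √W ≤ 2 * √N * √W := mul_le_mul_of_nonneg_right h2 (Real.sqrt_nonneg _)
    rw [Real.sqrt_mul (by positivity)]
    linarith

variable {G : Type*} [CommGroup G] [TopologicalSpace G] [CompactSpace G] [MeasurableSpace G]
  [BorelSpace G] (μ : Measure G) [IsProbabilityMeasure μ] {γ : ι → PontryaginDual G}

lemma tendstoInMeasure_trigPoly {f : Lp ℂ 2 μ}
    (hf : HasSum (fun i => a i • ContinuousMap.toLp 2 μ ℂ (characterFun (γ i))) f) :
    TendstoInMeasure μ (fun T x => trigPoly γ T a x) atTop f := by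
  refine (tendstoInMeasure_of_tendsto_Lp hf).congr_left fun T => ?_
  have : ∑ i ∈ T, a i • ContinuousMap.toLp 2 μ ℂ (characterFun (γ i)) =
      ContinuousMap.toLp 2 μ ℂ (trigPoly γ T a) := by
    simp [trigPoly]
  rw [this]
  exact ContinuousMap.coeFn_toLp μ _

variable [IsTopologicalGroup G] [μ.IsHaarMeasure]

lemma summable_smul_characterFun (hγ : Function.Injective γ)
    (ha : Summable fun i => ‖a i‖ ^ 2) :
    Summable fun i => a i • ContinuousMap.toLp 2 μ ℂ (characterFun (γ i)) := by
  classical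
  have hv : Orthonormal ℂ fun i => ContinuousMap.toLp 2 μ ℂ (characterFun (γ i)) := by
    rw [orthonormal_iff_ite]
    intro i j
    rw [ContinuousMap.inner_toLp, integral_characterFun_mul_conj]
    simp only [hγ.eq_iff, eq_comm]
  simpa using (hv.orthogonalFamily.summable_iff_norm_sq_summable a).2 ha

variable [Countable ι] {R : ℝ}

/-- The upper tail bound for Sidon series. -/
lemma SidonBound.measureReal_K12_le (hγ : Function.Injective γ) (hR : 1 ≤ R)
    (h : SidonBound μ (Set.range γ) R) (ha : Summable fun i => ‖a i‖ ^ 2) (ha0 : a ≠ 0)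
    {f : Lp ℂ 2 μ}
    (hf : HasSum (fun i => a i • ContinuousMap.toLp 2 μ ℂ (characterFun (γ i))) f)
    {c : ℝ} (hc : 12 * R ≤ c) {t : ℝ} (ht : 1 ≤ t) :
    μ.real {x | c * K12 a t ≤ ‖f x‖} ≤ Real.exp (-t ^ 2) := by
  classical
  have hfin := fun s (hs : (0 : ℝ) < s) => finite_setOf_lt_norm ha hs
  have ht0 : 0 < t := zero_lt_one.trans_le ht
  have hK := K12_pos ha ha0 ht0
  have hc0 : 0 < c := by linarith
  obtain ⟨A, hA⟩ := exists_isTopSet hfin ⌊t ^ 2⌋₊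
  have hKeq := hA.K12_eq hfin
  set N := ⌊t ^ 2⌋₊
  set K := K12 a t
  set W := ∑' i, if i ∈ A then 0 else ‖a i‖ ^ 2
  have hN : 1 ≤ N := Nat.le_floor (by exact_mod_cast one_le_pow₀ ht)
  have hNt : (N : ℝ) ≤ t ^ 2 := Nat.floor_le (by positivity)
  have htN : t ^ 2 < N + 1 := Nat.lt_floor_add_one _
  have hN' : (1 : ℝ) ≤ N := by exact_mod_cast hN
  have hW0 : 0 ≤ W := tsum_nonneg fun i => by split_ifs <;> positivity
  have hl0 : 0 ≤ ∑ i ∈ A, ‖a i‖ := Finset.sum_nonneg fun _ _ => norm_nonneg _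
  have htW : 0 ≤ t * √W := by positivity
  refine measureReal_le_of_tendstoInMeasure (tendstoInMeasure_trigPoly μ hf)
    (mul_pos hc0 hK) ?_
  filter_upwards [eventually_ge_atTop A] with T hT
  have h1 := h.measureReal_le μ hγ hR hT a hN (y := c / 4 * K) (by positivity) (by
    have h2 : N * ∑ i ∈ T \ A, ‖a i‖ ^ 2 ≤ K ^ 2 := by
      calc N * ∑ i ∈ T \ A, ‖a i‖ ^ 2 ≤ t ^ 2 * W :=
            mul_le_mul hNt (sum_sdiff_sq_le_tsum ha A T)
              (Finset.sum_nonneg fun _ _ => sq_nonneg _) (by positivity)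
        _ = (t * √W) ^ 2 := by rw [mul_pow, Real.sq_sqrt hW0]
        _ ≤ K ^ 2 := pow_le_pow_left₀ htW (by linarith) 2
    rw [mul_pow _ K]
    refine mul_le_mul (pow_le_pow_left₀ (by linarith) (by linarith) 2) h2 ?_ (by positivity)
    exact mul_nonneg (Nat.cast_nonneg _) (Finset.sum_nonneg fun _ _ => sq_nonneg _))
  refine (measureReal_mono fun x (hx : c * K / 2 ≤ _) => ?_).trans
    (h1.trans (Real.exp_le_exp.2 (by linarith)))
  have h3 : ∑ i ∈ A, ‖a i‖ ≤ c / 4 * K := by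
    refine le_trans (by linarith) (le_mul_of_one_le_left hK.le (by linarith))
  have h4 : ∑ i ∈ A, ‖a i‖ + c / 4 * K ≤ ‖trigPoly γ T a x‖ := by linarith
  exact h4

/-- The lower tail bound for Sidon series. -/
lemma SidonBound.le_measureReal_K12 (hγ : Function.Injective γ) (hR : 1 ≤ R)
    (h : SidonBound μ (Set.range γ) R) (ha : Summable fun i => ‖a i‖ ^ 2) {f : Lp ℂ 2 μ}
    (hf : HasSum (fun i => a i • ContinuousMap.toLp 2 μ ℂ (characterFun (γ i))) f)
    {t : ℝ} (ht : 0 < t) :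
    (4 * (24 * R ^ 2) ^ (4 * max 1 ⌊t ^ 2⌋₊))⁻¹ ≤
      μ.real {x | (96 * R)⁻¹ * K12 a t ≤ ‖f x‖} := by
  classical
  have hR0 : 0 < R := zero_lt_one.trans_le hR
  have hfin := fun s (hs : (0 : ℝ) < s) => finite_setOf_lt_norm ha hs
  obtain ⟨A, hA⟩ := exists_isTopSet hfin (max 1 ⌊t ^ 2⌋₊)
  have hK := K12_le_of_isTopSet ha ht hA
  have hm : 1 ≤ max 1 ⌊t ^ 2⌋₊ := le_max_left _ _
  set m := max 1 ⌊t ^ 2⌋₊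
  set L := ∑ i ∈ A, ‖a i‖ + √(m * ∑' i, if i ∈ A then 0 else ‖a i‖ ^ 2) with hLdef
  have hL0 : 0 ≤ L := add_nonneg (Finset.sum_nonneg fun _ _ => norm_nonneg _) (Real.sqrt_nonneg _)
  rcases hL0.eq_or_lt with hL | hL
  · have huniv : {x | (96 * R)⁻¹ * K12 a t ≤ ‖f x‖} = Set.univ := by
      refine Set.eq_univ_of_forall fun x => ?_
      have : (96 * R)⁻¹ * K12 a t ≤ ‖f x‖ := le_trans
        (mul_nonpos_of_nonneg_of_nonpos (by positivity) (by linarith)) (norm_nonneg _)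
      exact this
    rw [huniv, probReal_univ]
    refine inv_le_one_of_one_le₀ ?_
    have : (1 : ℝ) ≤ (24 * R ^ 2) ^ (4 * m) := one_le_pow₀ (by nlinarith)
    linarith
  · have hlim : Tendsto (fun T => ∑ i ∈ A, ‖a i‖ + √(m * ∑ i ∈ T \ A, ‖a i‖ ^ 2)) atTop (𝓝 L) :=
      ((tendsto_sum_sdiff_sq ha A).const_mul _).sqrt.const_add _
    have h1 := le_measureReal_of_tendstoInMeasure (tendstoInMeasure_trigPoly μ hf)
      (r := L / (24 * R)) (p := (4 * (24 * R ^ 2) ^ (4 * m))⁻¹) (by positivity) (by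
        filter_upwards [eventually_ge_atTop A, hlim.eventually (lt_mem_nhds (half_lt_self hL))]
          with T hT hLT
        refine (h.le_measureReal μ hγ hR hT a hm hA ((half_pos hL).trans hLT)).trans
          (measureReal_mono fun x (hx : _ ≤ ‖trigPoly γ T a x‖) => ?_)
        have : L / (24 * R) ≤ ‖trigPoly γ T a x‖ := by
          refine le_trans ?_ hx
          rw [show L / (24 * R) = L / 2 / (12 * R) by field_simp; norm_num]
          exact div_le_div_of_nonneg_right hLT.le (by positivity)
        exact this)
    refine h1.trans (measureReal_mono fun x (hx : _ ≤ ‖f x‖) => ?_)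
    have : (96 * R)⁻¹ * K12 a t ≤ ‖f x‖ := by
      refine le_trans ?_ hx
      calc (96 * R)⁻¹ * K12 a t ≤ (96 * R)⁻¹ * (2 * L) :=
            mul_le_mul_of_nonneg_left hK (by positivity)
        _ = L / (24 * R) / 2 := by field_simp; norm_num
    exact this

end SidonSeries

/-! ### The distribution of Sidon series -/

theorem theorem3p9 (S : ℝ) :
    ∃ c : ℝ, 0 < c ∧
      ∀ (G : Type u) [CommGroup G] [TopologicalSpace G] [IsTopologicalGroup G] [CompactSpace G]
        [T2Space G] [MeasurableSpace G] [BorelSpace G]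
        (μ : Measure G) [μ.IsHaarMeasure] [IsProbabilityMeasure μ]
        (ι : Type v) [Countable ι] (γ : ι → PontryaginDual G),
        Function.Injective γ → IsSidon μ (Set.range γ) → sidonConstant μ (Set.range γ) = S →
        ∀ a : ι → ℂ, Memℓp a 2 →
          ∃ f : Lp ℂ 2 μ,
            HasSum (fun i => a i • ContinuousMap.toLp 2 μ ℂ (characterFun (γ i))) f ∧
            ∀ t : ℝ, 0 < t →
              (a ≠ 0 → μ.real {x | c * K12 a t ≤ ‖f x‖} ≤ c * Real.exp (-(c⁻¹ * t ^ 2))) ∧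
              c⁻¹ * Real.exp (-(c * t ^ 2)) ≤ μ.real {x | c⁻¹ * K12 a t ≤ ‖f x‖} := by
  -- `R` exceeds the Sidon constant, so it is admissible whether or not the infimum is attained.
  set R := |S| + 1 with hRdef
  have hR : 1 ≤ R := by have := abs_nonneg S; linarith
  set Q := 24 * R ^ 2 with hQdef
  have hQR : 24 * R ≤ Q := by nlinarith
  have hQ : 24 ≤ Q := by linarith
  have hQ4 : Q ≤ Q ^ 4 := le_self_pow₀ (by linarith) (by norm_num)
  have hlog : Real.log Q ≤ Q ^ 4 := (Real.log_le_self (by linarith)).trans hQ4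
  have hc0 : 0 < 4 * Q ^ 4 := by positivity
  refine ⟨4 * Q ^ 4, hc0, ?_⟩
  set c := 4 * Q ^ 4 with hc
  intro G _ _ _ _ _ _ _ μ _ _ ι _ γ hγ hE hS a ha
  have h : SidonBound μ (Set.range γ) R := by
    have hlt : sidonConstant μ (Set.range γ) < R := by linarith [le_abs_self S]
    obtain ⟨d, ⟨-, hd⟩, hdR⟩ := exists_lt_of_csInf_lt
      (s := {c : ℝ | 0 < c ∧ SidonBound μ (Set.range γ) c}) hE hlt
    exact hd.mono hdR.le
  have ha2 : Summable fun i => ‖a i‖ ^ 2 := by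
    simpa using (memℓp_gen_iff (by simp)).1 ha
  obtain ⟨f, hf⟩ := summable_smul_characterFun μ hγ ha2
  refine ⟨f, hf, fun t ht => ⟨fun ha0 => ?_, ?_⟩⟩
  · have hc1 : c⁻¹ ≤ 1 := inv_le_one_of_one_le₀ (by linarith)
    rcases lt_or_ge t 1 with h1 | h1
    · -- Here the right-hand side is at least one.
      have h2 : c⁻¹ * t ^ 2 ≤ 1 := mul_le_one₀ hc1 (by positivity) (pow_le_one₀ ht.le h1.le)
      have h3 : Real.exp (-1) ≤ Real.exp (-(c⁻¹ * t ^ 2)) := Real.exp_le_exp.2 (by linarith)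
      have h4 : 1 ≤ c * Real.exp (-1) := by
        rw [Real.exp_neg, ← div_eq_mul_inv, one_le_div (Real.exp_pos 1)]
        linarith [Real.exp_one_lt_d9]
      exact measureReal_le_one.trans (h4.trans (mul_le_mul_of_nonneg_left h3 hc0.le))
    · refine (h.measureReal_K12_le μ hγ hR ha2 ha0 hf (by linarith) h1).trans ?_
      refine (Real.exp_le_exp.2 (neg_le_neg ?_)).trans
        (le_mul_of_one_le_left (Real.exp_pos _).le (by linarith))
      exact mul_le_of_le_one_left (by positivity) hc1
  · have hK : 0 ≤ K12 a t := add_nonneg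
      (Finset.sum_nonneg fun n _ => rearrangement_nonneg a n)
      (mul_nonneg ht.le (Real.sqrt_nonneg _))
    have h1 := h.le_measureReal_K12 μ hγ hR ha2 hf ht
    have hcR : c⁻¹ ≤ (96 * R)⁻¹ := inv_anti₀ (by linarith) (by linarith)
    refine le_trans ?_ (h1.trans (measureReal_mono fun x (hx : _ ≤ ‖f x‖) => ?_))
    · have hm : ((max 1 ⌊t ^ 2⌋₊ : ℕ) : ℝ) ≤ 1 + t ^ 2 := by
        push_cast
        refine max_le (by linarith [sq_nonneg t]) ?_
        linarith [Nat.floor_le (sq_nonneg t)]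
      rw [Real.exp_neg, ← mul_inv]
      refine inv_anti₀ (by positivity) ?_
      have h2 : Q ^ (4 * max 1 ⌊t ^ 2⌋₊) ≤ Q ^ 4 * Real.exp (c * t ^ 2) := by
        have hpow : ∀ n : ℕ, Q ^ n = Real.exp (n * Real.log Q) := fun n => by
          rw [Real.exp_nat_mul, Real.exp_log (by linarith)]
        have hlog0 : 0 ≤ Real.log Q := Real.log_nonneg (by linarith)
        rw [hpow, hpow, ← Real.exp_add]
        refine Real.exp_le_exp.2 ?_
        push_cast at hm ⊢
        calc 4 * max 1 (⌊t ^ 2⌋₊ : ℝ) * Real.log Q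
            ≤ 4 * (1 + t ^ 2) * Real.log Q :=
              mul_le_mul_of_nonneg_right (by linarith) hlog0
          _ = 4 * Real.log Q + 4 * Real.log Q * t ^ 2 := by ring
          _ ≤ 4 * Real.log Q + c * t ^ 2 := by
              have : 4 * Real.log Q ≤ c := by linarith
              linarith [mul_le_mul_of_nonneg_right this (sq_nonneg t)]
      calc 4 * Q ^ (4 * max 1 ⌊t ^ 2⌋₊) ≤ 4 * (Q ^ 4 * Real.exp (c * t ^ 2)) := by linarith
        _ = c * Real.exp (c * t ^ 2) := by rw [hc]; ring
    · have : c⁻¹ * K12 a t ≤ ‖f x‖ := (mul_le_mul_of_nonneg_right hcR hK).trans hx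
      exact this
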